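/- Let $(M^3,J)$ be a three-dimensional (strictly pseudoconvex) CR manifold: a smooth $3$-manifold with a smooth plane field $H\subset TM$ and a smooth, formally integrable complex structure $J\colon H\to H$. Let $\theta$ be a contact form on $M$, i.e. a smooth real one-form with $\ker\theta=H$ such that $d\theta(\cdot,J\cdot)$ is positive definite on $H$, and let $T$ be its Reeb field ($\theta(T)=1$, $T\lrcorner d\theta=0$). Let $T^{1,0}$ be the $i$-eigenspace of $J$ in $H\otimes\mathbb C$ and $T^{0,1}=\overline{T^{1,0}}$; a $(1,0)$-form is a complex one-form annihilating $T^{0,1}$, and the canonical bundle is $K=\Lambda^2(\Lambda^{1,0})$. An admissible coframe on an open set $U$ is a smooth $(1,0)$-form $\theta^1$ on $U$ with $\theta^1(T)=0$ whose restriction to $T^{1,0}$ is nowhere zero; write $\theta^{\bar 1}=\overline{\theta^1}$ and let $\{T,Z_1,Z_{\bar 1}\}$ be the frame dual to $\{\theta,\theta^1,\theta^{\bar 1}\}$. Then $d\theta=ih\,\theta^1\wedge\theta^{\bar 1}$ with $h>0$, and the Tanaka--Webster connection form $\omega=\omega_1{}^1$, torsion $A=A_{11}$ and real scalar curvature $R$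 are determined by $$d\theta^1=\theta^1\wedge\omega+h^{-1}\overline{A}\,\theta\wedge\theta^{\bar 1},\qquad h\omega+h\overline{\omega}=dh,\qquad d\omega\equiv R\,h\,\theta^1\wedge\theta^{\bar 1}\mod\theta .$$ The contact form $\theta$ is pseudo-Einstein if $\nabla_\alpha R-i\nabla^\beta A_{\alpha\beta}=0$, that is, if in every admissible coframe on every open set $$Z_1R-ih^{-1}\bigl(Z_{\bar 1}A-2\omega(Z_{\bar 1})A\bigr)=0 .$$ It is volume-normalized with respect to a nowhere vanishing section $\xi$ of $K$ if $\theta\wedge d\theta=i\,\theta\wedge(T\lrcorner\xi)\wedge(T\lrcorner\overline{\xi})$. Theorem. (a) $\theta$ is pseudo-Einstein if and only if for each point $p\in M$ there exist a neighborhood $U$ of $p$ and a smooth, nowhere vanishing, closed section of $K$ over $U$ with respect to which $\theta$ is volume-normalized on $U$. (b) $\theta$ is pseudo-Einstein if and only if, with respect to every admissible coframe on every open subset of $M$, the one-form $\omega_1{}^1+iR\theta$ is closed. -/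

import Mathlib

open scoped Manifold ContDiff TensorProduct ComplexConjugate
open Set

noncomputable section

namespace CR

/-! ### Exterior algebra on one tangent space -/

section Pointwise

variable {V : Type*} [AddCommGroup V] [Module ℝ V] [TopologicalSpace V]
variable {k : ℕ}

/-- The linear map underlying a `1`-form. -/
def toLin (α : V [⋀^Fin 1]→L[ℝ] ℂ) : V →ₗ[ℝ] ℂ :=
  (((ContinuousAlternatingMap.ofSubsingleton ℝ V ℂ (0 : Fin 1)).symm α : V →L[ℝ] ℂ) : V →ₗ[ℝ] ℂ)

theorem toLin_apply (α : V [⋀^Fin 1]→L[ℝ] ℂ) (v : V) : toLin α v = α ![v] := by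
  have : (fun _ : Fin 1 => v) = ![v] := by ext i; simp
  rw [← this]; rfl

/-- The complex-linear extension of a complex-valued `1`-form to the complexified space. -/
def ext (α : V [⋀^Fin 1]→L[ℝ] ℂ) : (ℂ ⊗[ℝ] V) →ₗ[ℂ] ℂ :=
  (toLin α).liftBaseChange ℂ

theorem ext_tmul (α : V [⋀^Fin 1]→L[ℝ] ℂ) (c : ℂ) (v : V) : ext α (c ⊗ₜ v) = c * α ![v] := by
  simp [ext, toLin_apply]

/-- The wedge product of a `1`-form with a `k`-form,
`(α ∧ β)(v₀, …, v_k) = ∑ᵢ (-1)ⁱ α(vᵢ) β(v₀, …, v̂ᵢ, …, v_k)`. -/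
def wedge (α : V [⋀^Fin 1]→L[ℝ] ℂ) (β : V [⋀^Fin k]→L[ℝ] ℂ) : V [⋀^Fin (k + 1)]→L[ℝ] ℂ :=
  { AlternatingMap.alternatizeUncurryFin ((toLin α).smulRight β.toAlternatingMap) with
    cont := by
      have h : ∀ i : Fin (k + 1), Continuous fun v : Fin (k + 1) → V =>
          (-1 : ℤ) ^ (i : ℕ) • (α ![v i] * β (i.removeNth v)) := by
        intro i
        refine Continuous.const_smul (Continuous.mul ?_ ?_) _
        · refine α.toContinuousMultilinearMap.cont.comp (continuous_pi fun j => ?_)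
          simpa [Subsingleton.elim j 0] using continuous_apply i
        · exact β.toContinuousMultilinearMap.cont.comp
            (continuous_pi fun j => continuous_apply (i.succAbove j))
      refine (continuous_finsetSum Finset.univ fun i _ => h i).congr fun v => ?_
      simp [AlternatingMap.alternatizeUncurryFin_apply, toLin_apply] }

theorem wedge_apply (α : V [⋀^Fin 1]→L[ℝ] ℂ) (β : V [⋀^Fin k]→L[ℝ] ℂ) (v : Fin (k + 1) → V) :
    wedge α β v = ∑ i : Fin (k + 1), (-1 : ℤ) ^ (i : ℕ) • (α ![v i] * β (i.removeNth v)) := by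
  change AlternatingMap.alternatizeUncurryFin ((toLin α).smulRight β.toAlternatingMap) v = _
  simp [AlternatingMap.alternatizeUncurryFin_apply, toLin_apply]

/-- The contraction `v ⌟ β = β(v, ⋅, …, ⋅)`. -/
def contract (v : V) (β : V [⋀^Fin (k + 1)]→L[ℝ] ℂ) : V [⋀^Fin k]→L[ℝ] ℂ :=
  { β.toAlternatingMap.curryLeft v with
    cont := β.toContinuousMultilinearMap.cont.comp
      (continuous_pi (Fin.cases continuous_const fun j => continuous_apply j)) }

theorem contract_apply (v : V) (β : V [⋀^Fin (k + 1)]→L[ℝ] ℂ) (w : Fin k → V) :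
    contract v β w = β (Matrix.vecCons v w) := rfl

/-- The complex conjugate of a complex-valued form. -/
def conjForm (β : V [⋀^Fin k]→L[ℝ] ℂ) : V [⋀^Fin k]→L[ℝ] ℂ :=
  (Complex.conjCLE : ℂ →L[ℝ] ℂ).compContinuousAlternatingMap β

/-- A real-valued form, regarded as a complex-valued one. -/
def ofRealForm (β : V [⋀^Fin k]→L[ℝ] ℝ) : V [⋀^Fin k]→L[ℝ] ℂ :=
  Complex.ofRealCLM.compContinuousAlternatingMap β

end Pointwise

/-! ### Vector fields and differential forms on a three-manifold -/

/-- The model space. -/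
abbrev E3 : Type := EuclideanSpace ℝ (Fin 3)

section Forms

variable (M : Type*) [TopologicalSpace M] [ChartedSpace E3 M]

/-- A (not necessarily smooth) vector field on `M`. -/
abbrev VField : Type _ := ∀ x : M, TangentSpace (𝓡 3) x

/-- A (not necessarily smooth) `k`-form on `M` with values in `F`. -/
abbrev Form (F : Type*) [NormedAddCommGroup F] [NormedSpace ℝ F] (k : ℕ) : Type _ :=
  ∀ x : M, TangentSpace (𝓡 3) x [⋀^Fin k]→L[ℝ] F

variable {M}
variable {F : Type*} [NormedAddCommGroup F] [NormedSpace ℝ F] {k : ℕ}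

/-- The vector field `X` is smooth on the open set `U`. -/
def VField.SmoothOn [IsManifold (𝓡 3) ∞ M] (X : VField M) (U : Set M) : Prop :=
  ContMDiffOn (𝓡 3) (𝓡 3).tangent ∞ (fun x => (⟨x, X x⟩ : TangentBundle (𝓡 3) M)) U

/-- The expression of the form `β` in the preferred chart `φ` at `p`, that is, `(φ⁻¹)^* β`.
It is meaningful on the target of the chart. -/
def Form.inChart (β : Form M F k) (p : M) : E3 → E3 [⋀^Fin k]→L[ℝ] F := fun y =>
  (β ((extChartAt (𝓡 3) p).symm y)).compContinuousLinearMap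
    (mfderiv 𝓘(ℝ, E3) (𝓡 3) (extChartAt (𝓡 3) p).symm y)

/-- The form `β` is smooth on the open set `U`. -/
def Form.SmoothOn (β : Form M F k) (U : Set M) : Prop :=
  ∀ p ∈ U, ContDiffAt ℝ ∞ (Form.inChart β p) (extChartAt (𝓡 3) p p)

/-- The exterior derivative: at `p` it is computed in the preferred chart at `p` and pulled back
to `M`. The normalization is `dα(X, Y) = X(α(Y)) - Y(α(X)) - α([X, Y])`. -/
def Form.d (β : Form M F k) : Form M F (k + 1) := fun p =>
  (extDeriv (Form.inChart β p) (extChartAt (𝓡 3) p p)).compContinuousLinearMap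
    (mfderiv (𝓡 3) 𝓘(ℝ, E3) (extChartAt (𝓡 3) p) p)

/-- The differential of a complex-valued function, as a `1`-form. -/
def dFun (f : M → ℂ) : Form M ℂ 1 := fun x =>
  ContinuousAlternatingMap.ofSubsingleton ℝ (TangentSpace (𝓡 3) x) ℂ (0 : Fin 1)
    (mfderiv (𝓡 3) 𝓘(ℝ, ℂ) f x)

/-- A complex-valued function that is smooth on the open set `U`. -/
def FunSmoothOn (f : M → ℂ) (U : Set M) : Prop := ContMDiffOn (𝓡 3) 𝓘(ℝ, ℂ) ∞ f U

end Forms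

/-! ### CR structures and contact forms -/

section CRManifold

variable {M : Type*} [TopologicalSpace M] [ChartedSpace E3 M] [IsManifold (𝓡 3) ∞ M]

variable (M) in
/-- A CR structure on a three-manifold: a smooth plane field `H ⊆ TM` with a smooth, formally
integrable complex structure `J : H → H`. (Nondegeneracy and strict pseudoconvexity are
expressed through a contact form, see `ContactForm`.) -/
structure CRStructure where
  /-- the plane field -/
  H : ∀ x : M, Submodule ℝ (TangentSpace (𝓡 3) x)
  /-- the complex structure -/
  J : ∀ x : M, H x →ₗ[ℝ] H x
  J_sq : ∀ (x : M) (v : H x), J x (J x v) = -v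
  /-- `H` has local frames of smooth vector fields. -/
  smooth_H : ∀ p : M, ∃ U : Set M, IsOpen U ∧ p ∈ U ∧ ∃ X Y : VField M,
    VField.SmoothOn X U ∧ VField.SmoothOn Y U ∧ ∀ x ∈ U,
      LinearIndependent ℝ ![X x, Y x] ∧ Submodule.span ℝ {X x, Y x} = H x
  /-- `J` maps smooth local sections of `H` to smooth local sections. -/
  smooth_J : ∀ (U : Set M) (X Y : VField M), IsOpen U → VField.SmoothOn X U →
    (∀ x ∈ U, ∃ h : X x ∈ H x, (J x ⟨X x, h⟩ : TangentSpace (𝓡 3) x) = Y x) →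
    VField.SmoothOn Y U
  /-- Formal integrability `[T^{1,0}, T^{1,0}] ⊆ T^{1,0}`: for local sections `X`, `Y` of `H`, with
  `X' = J X` and `Y' = J Y`, the field `[X - iX', Y - iY']` is a section of `T^{1,0}`, that is,
  `[X, Y] - [X', Y']` lies in `H` and is mapped by `J` to `[X', Y] + [X, Y']`. -/
  integrable : ∀ (U : Set M) (X Y X' Y' : VField M), IsOpen U →
    VField.SmoothOn X U → VField.SmoothOn Y U →
    (∀ x ∈ U, ∃ h : X x ∈ H x, (J x ⟨X x, h⟩ : TangentSpace (𝓡 3) x) = X' x) →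
    (∀ x ∈ U, ∃ h : Y x ∈ H x, (J x ⟨Y x, h⟩ : TangentSpace (𝓡 3) x) = Y' x) →
    ∀ x ∈ U, ∃ h : VectorField.mlieBracket (𝓡 3) X Y x - VectorField.mlieBracket (𝓡 3) X' Y' x
        ∈ H x,
      (J x ⟨_, h⟩ : TangentSpace (𝓡 3) x) =
        VectorField.mlieBracket (𝓡 3) X' Y x + VectorField.mlieBracket (𝓡 3) X Y' x

variable (S : CRStructure M)

/-- `T^{1,0}`, the `i`-eigenspace of `J` on `ℂ ⊗ H`, spanned by the vectors `v - i J v`. -/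
def CRStructure.T10 (x : M) : Submodule ℂ (ℂ ⊗[ℝ] TangentSpace (𝓡 3) x) :=
  Submodule.span ℂ (range fun v : S.H x =>
    (1 : ℂ) ⊗ₜ[ℝ] (v : TangentSpace (𝓡 3) x) -
      Complex.I ⊗ₜ[ℝ] (S.J x v : TangentSpace (𝓡 3) x))

/-- `T^{0,1}`, the conjugate of `T^{1,0}`, spanned by the vectors `v + i J v`. -/
def CRStructure.T01 (x : M) : Submodule ℂ (ℂ ⊗[ℝ] TangentSpace (𝓡 3) x) :=
  Submodule.span ℂ (range fun v : S.H x =>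
    (1 : ℂ) ⊗ₜ[ℝ] (v : TangentSpace (𝓡 3) x) +
      Complex.I ⊗ₜ[ℝ] (S.J x v : TangentSpace (𝓡 3) x))

/-- `Λ^{1,0}`: the complex covectors that annihilate `T^{0,1}`. -/
def CRStructure.Is10 (x : M) (α : TangentSpace (𝓡 3) x [⋀^Fin 1]→L[ℝ] ℂ) : Prop :=
  ∀ z ∈ S.T01 x, ext α z = 0

/-- The fibre of the canonical bundle `K = Λ²(Λ^{1,0})`. -/
def CRStructure.K (x : M) : Submodule ℂ (TangentSpace (𝓡 3) x [⋀^Fin 2]→L[ℝ] ℂ) :=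
  Submodule.span ℂ {ξ | ∃ α β : TangentSpace (𝓡 3) x [⋀^Fin 1]→L[ℝ] ℂ,
    S.Is10 x α ∧ S.Is10 x β ∧ ξ = wedge α β}

/-- A smooth section over `U` of the canonical bundle. -/
def CRStructure.IsCanonicalSection (U : Set M) (ξ : Form M ℂ 2) : Prop :=
  Form.SmoothOn ξ U ∧ ∀ x ∈ U, ξ x ∈ S.K x

/-- A contact form: a smooth real `1`-form `θ` with kernel `H` such that `dθ(⋅, J⋅)` is positive
definite on `H`. The existence of such a form means that the CR structure is strictly pseudoconvex
(in particular `H` is maximally nonintegrable) and that `M` is orientable. -/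
structure ContactForm where
  /-- the form -/
  form : Form M ℝ 1
  smooth : Form.SmoothOn form univ
  ker : ∀ (x : M) (v : TangentSpace (𝓡 3) x), form x ![v] = 0 ↔ v ∈ S.H x
  pos : ∀ (x : M) (v : S.H x), v ≠ 0 →
    0 < Form.d form x ![(v : TangentSpace (𝓡 3) x), (S.J x v : TangentSpace (𝓡 3) x)]

end CRManifold

section Pseudohermitian

variable {M : Type*} [TopologicalSpace M] [ChartedSpace E3 M] [IsManifold (𝓡 3) ∞ M] {S : CRStructure M}

/-- `θ` as a complex-valued form. -/
def ContactForm.toC (θ : ContactForm S) : Form M ℂ 1 := fun x => ofRealForm (θ.form x)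

/-- `dθ` as a complex-valued form. -/
def ContactForm.dC (θ : ContactForm S) : Form M ℂ 2 := fun x => ofRealForm (Form.d θ.form x)

/-- A covector that is not identically zero and an alternating bilinear form that is nonzero on a
basis `X, Y` of its kernel determine a unique vector. -/
theorem reeb_aux {V : Type*} [AddCommGroup V] [Module ℝ V] (t : V →ₗ[ℝ] ℝ)
    (B : V →ₗ[ℝ] V →ₗ[ℝ] ℝ) (hB : ∀ v, B v v = 0) (u X Y : V) (hu : t u ≠ 0)
    (hker : ∀ v, t v = 0 ↔ ∃ a b : ℝ, a • X + b • Y = v) (hXY : B X Y ≠ 0) :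
    ∃! T : V, t T = 1 ∧ ∀ v, B T v = 0 := by
  have hanti : ∀ v w, B v w = -B w v := by
    intro v w
    have h := hB (v + w)
    simp only [map_add, LinearMap.add_apply, hB] at h
    linarith
  have hX : t X = 0 := (hker X).2 ⟨1, 0, by simp⟩
  have hY : t Y = 0 := (hker Y).2 ⟨0, 1, by simp⟩
  have hYX : B Y X = -B X Y := hanti Y X
  have hdec : ∀ v, ∃ a b : ℝ, v = (t v / t u) • u + (a • X + b • Y) := by
    intro v
    obtain ⟨a, b, hab⟩ := (hker (v - (t v / t u) • u)).1 (by
      simp only [map_sub, map_smul, smul_eq_mul]; field_simp; ring)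
    exact ⟨a, b, by rw [hab]; abel⟩
  obtain ⟨u', hu'⟩ : ∃ u' : V, u' = (t u)⁻¹ • u := ⟨_, rfl⟩
  have htu' : t u' = 1 := by simp [hu', hu]
  refine ⟨u' + ((-(B u' Y) / B X Y) • X + (B u' X / B X Y) • Y), ⟨?_, ?_⟩, ?_⟩
  · simp [htu', hX, hY]
  · set T := u' + ((-(B u' Y) / B X Y) • X + (B u' X / B X Y) • Y) with hT
    have h1 : B T X = 0 := by
      simp only [hT, map_add, map_smul, LinearMap.add_apply, LinearMap.smul_apply, hB, hYX,
        smul_eq_mul]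
      field_simp; ring
    have h2 : B T Y = 0 := by
      simp only [hT, map_add, map_smul, LinearMap.add_apply, LinearMap.smul_apply, hB,
        smul_eq_mul]
      field_simp; ring
    have h3 : B T u' = 0 := by
      have h := hB T
      have h5 : B T T = B T u' + ((-(B u' Y) / B X Y) * B T X + (B u' X / B X Y) * B T Y) := by
        conv_lhs => rw [hT, ← hT]
        conv_lhs => arg 2; rw [hT]
        simp only [map_add, map_smul, smul_eq_mul]
      rw [h, h1, h2] at h5
      linarith
    have h4 : B T u = 0 := by
      have : u = t u • u' := by rw [hu', smul_smul, mul_inv_cancel₀ hu, one_smul]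
      rw [this, map_smul, h3, smul_zero]
    intro v
    obtain ⟨a, b, hv⟩ := hdec v
    rw [hv]
    simp only [map_add, map_smul, h1, h2, h4, smul_zero, add_zero]
  · rintro T' ⟨hT1, hT2⟩
    obtain ⟨a, b, hv⟩ := hdec T'
    rw [hT1, one_div, ← hu'] at hv
    have h1 := hT2 X
    have h2 := hT2 Y
    rw [hv] at h1 h2
    simp only [map_add, map_smul, LinearMap.add_apply, LinearMap.smul_apply, hB, hYX,
      smul_eq_mul] at h1 h2
    have ha : a = -(B u' Y) / B X Y := by field_simp; linarith
    have hb : b = B u' X / B X Y := by field_simp; linarith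
    rw [hv, ha, hb]

/-- The Reeb vector at each point exists and is unique. -/
theorem ContactForm.existsUnique_reeb (θ : ContactForm S) (x : M) :
    ∃! T : TangentSpace (𝓡 3) x, θ.form x ![T] = 1 ∧
      ∀ v : TangentSpace (𝓡 3) x, Form.d θ.form x ![T, v] = 0 := by
  classical
  set V := TangentSpace (𝓡 3) x
  have e1 : ∀ a b : V, Function.update ![a] 0 b = ![b] := fun a b => by
    ext i; fin_cases i; simp
  have e2 : ∀ a b c : V, Function.update ![a, c] 0 b = ![b, c] := fun a b c => by
    ext i; fin_cases i <;> simp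
  have e3 : ∀ a b c : V, Function.update ![a, c] 1 b = ![a, b] := fun a b c => by
    ext i; fin_cases i <;> simp
  let t : V →ₗ[ℝ] ℝ :=
    { toFun := fun v => θ.form x ![v]
      map_add' := fun v w => by
        have h := (θ.form x).map_update_add ![v] 0 v w
        simpa only [e1] using h
      map_smul' := fun c v => by
        rw [RingHom.id_apply]
        have h := (θ.form x).map_update_smul ![v] 0 c v
        simpa only [e1] using h }
  let B : V →ₗ[ℝ] V →ₗ[ℝ] ℝ := LinearMap.mk₂ ℝ (fun v w => Form.d θ.form x ![v, w])
    (fun v w z => by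
      have h := (Form.d θ.form x).map_update_add ![v, z] 0 v w
      simpa only [e2, e3] using h)
    (fun c v z => by
      have h := (Form.d θ.form x).map_update_smul ![v, z] 0 c v
      simpa only [e2, e3] using h)
    (fun v w z => by
      have h := (Form.d θ.form x).map_update_add ![v, w] 1 w z
      simpa only [e2, e3] using h)
    (fun c v z => by
      have h := (Form.d θ.form x).map_update_smul ![v, z] 1 c z
      simpa only [e2, e3] using h)
  have hB : ∀ v, B v v = 0 := fun v =>
    (Form.d θ.form x).map_eq_zero_of_eq ![v, v] (i := 0) (j := 1) (by simp) (by simp)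
  obtain ⟨U, -, hxU, X, Y, -, -, hXY⟩ := S.smooth_H x
  obtain ⟨hli, hspan⟩ := hXY x hxU
  have hmem : ∀ v : V, v ∈ S.H x ↔ ∃ a b : ℝ, a • X x + b • Y x = v := fun v => by
    rw [← hspan, Submodule.mem_span_pair]
  have hker : ∀ v : V, t v = 0 ↔ ∃ a b : ℝ, a • X x + b • Y x = v := fun v =>
    (θ.ker x v).trans (hmem v)
  have hXH : X x ∈ S.H x := (hmem _).2 ⟨1, 0, by simp⟩
  have hX0 : X x ≠ 0 := by simpa using hli.ne_zero 0
  have hB0 : B (X x) (Y x) ≠ 0 := by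
    intro h0
    obtain ⟨a, b, hab⟩ := (hmem _).1 (S.J x ⟨X x, hXH⟩).2
    have h := θ.pos x ⟨X x, hXH⟩ (fun h => hX0 (congrArg Subtype.val h))
    change 0 < B (X x) (S.J x ⟨X x, hXH⟩ : V) at h
    rw [← hab, map_add, map_smul, map_smul, hB, h0] at h
    simp at h
  have hu : ∃ u : V, t u ≠ 0 := by
    by_contra hcon
    push Not at hcon
    have htop : S.H x = ⊤ := by
      rw [eq_top_iff]
      intro v _
      exact (θ.ker x v).1 (hcon v)
    have h1 : Module.finrank ℝ (S.H x) = 2 := by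
      rw [← hspan]
      have := finrank_span_eq_card hli
      rw [show range ![X x, Y x] = {X x, Y x} by
        simp [Matrix.range_cons, Set.pair_comm]] at this
      simpa using this
    have h2 : Module.finrank ℝ V = 3 := by
      change Module.finrank ℝ E3 = 3
      simp
    rw [htop, finrank_top, h2] at h1
    omega
  obtain ⟨u, hu⟩ := hu
  exact reeb_aux t B hB u (X x) (Y x) hu hker hB0

/-- The Reeb vector field: `θ(T) = 1` and `T ⌟ dθ = 0`. -/
def ContactForm.reeb (θ : ContactForm S) : VField M := fun x =>
  (θ.existsUnique_reeb x).choose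

/-- `θ` is volume-normalized on `U` with respect to the section `ξ` of the canonical bundle:
`θ ∧ dθ = i θ ∧ (T ⌟ ξ) ∧ (T ⌟ ξ̄)`. -/
def ContactForm.VolumeNormalizedOn (θ : ContactForm S) (U : Set M) (ξ : Form M ℂ 2) : Prop :=
  ∀ x ∈ U, wedge (θ.toC x) (θ.dC x) =
    Complex.I • wedge (θ.toC x)
      (wedge (contract (θ.reeb x) (ξ x)) (contract (θ.reeb x) (conjForm (ξ x))))

/-- An admissible coframe `θ¹` over the open set `U`, together with its conjugate: a smooth
`(1,0)`-form that does not vanish on the line `T^{1,0}` and that annihilates the Reeb field. -/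
structure ContactForm.AdmissibleCoframe (θ : ContactForm S) (U : Set M) where
  /-- the form `θ¹` -/
  form : Form M ℂ 1
  smooth : Form.SmoothOn form U
  is10 : ∀ x ∈ U, S.Is10 x (form x)
  basis : ∀ x ∈ U, ∃ z ∈ S.T10 x, ext (form x) z ≠ 0
  reeb : ∀ x ∈ U, form x ![θ.reeb x] = 0

/-- The conjugate `θ^1̄` of the coframe form `θ¹`. -/
def ContactForm.AdmissibleCoframe.bar {θ : ContactForm S} {U : Set M} (e : θ.AdmissibleCoframe U) :
    Form M ℂ 1 := fun x => conjForm (e.form x)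

/-- The components, in the admissible coframe `θ¹`, of the Levi form, of the Tanaka-Webster
connection, and of its torsion and curvature. Each of them is uniquely determined on `U` by the
relation that defines it. -/
structure ContactForm.TanakaWebster (θ : ContactForm S) {U : Set M}
    (e : θ.AdmissibleCoframe U) where
  /-- the Levi form `h = h_{1 1̄}` -/
  h : M → ℝ
  /-- the complex vector fields `Z₁` and `Z_1̄` of the frame `T, Z₁, Z_1̄` dual to
  `θ, θ¹, θ^1̄` -/
  Z : ∀ x : M, ℂ ⊗[ℝ] TangentSpace (𝓡 3) x
  /-- see `Z` -/
  Zbar : ∀ x : M, ℂ ⊗[ℝ] TangentSpace (𝓡 3) x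
  /-- the connection form `ω_1^1` -/
  conn : Form M ℂ 1
  /-- the torsion component `A = A_{11}`, so that `τ_1 = A θ¹` and
  `τ^1 = h⁻¹ Ā θ^1̄` -/
  A : M → ℂ
  /-- the scalar curvature `R = R_1^1`, so that `R_{1 1̄} = R h` -/
  R : M → ℝ
  h_smooth : FunSmoothOn (fun x => (h x : ℂ)) U
  h_pos : ∀ x ∈ U, 0 < h x
  /-- `dθ = i h θ¹ ∧ θ^1̄` -/
  levi : ∀ x ∈ U, θ.dC x = (Complex.I * h x) • wedge (e.form x) (e.bar x)
  Z_dual : ∀ x ∈ U, ext (θ.toC x) (Z x) = 0 ∧ ext (e.form x) (Z x) = 1 ∧ ext (e.bar x) (Z x) = 0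
  Zbar_dual : ∀ x ∈ U,
    ext (θ.toC x) (Zbar x) = 0 ∧ ext (e.form x) (Zbar x) = 0 ∧ ext (e.bar x) (Zbar x) = 1
  conn_smooth : Form.SmoothOn conn U
  A_smooth : FunSmoothOn A U
  /-- `dθ¹ = θ¹ ∧ ω_1^1 + θ ∧ τ^1` -/
  structure_eq : ∀ x ∈ U, Form.d e.form x = wedge (e.form x) (conn x) +
    wedge (θ.toC x) (((h x : ℂ)⁻¹ * conj (A x)) • e.bar x)
  /-- `ω_{1 1̄} + ω_{1̄ 1} = dh` -/
  metric : ∀ x ∈ U, (h x : ℂ) • conn x + (h x : ℂ) • conjForm (conn x) = dFun (fun y => (h y : ℂ)) x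
  R_smooth : FunSmoothOn (fun x => (R x : ℂ)) U
  /-- `dω_1^1 = R_{1 1̄} θ¹ ∧ θ^1̄` modulo `θ` -/
  curvature : ∀ x ∈ U, ∃ η : TangentSpace (𝓡 3) x [⋀^Fin 1]→L[ℝ] ℂ,
    Form.d conn x = ((R x : ℂ) * h x) • wedge (e.form x) (e.bar x) + wedge (θ.toC x) η

namespace ContactForm.TanakaWebster

variable {θ : ContactForm S} {U : Set M} {e : θ.AdmissibleCoframe U} (D : θ.TanakaWebster e)

/-- `∇_1 R = Z₁ R`. -/
def gradR (x : M) : ℂ := ext (dFun (fun y => (D.R y : ℂ)) x) (D.Z x)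

/-- `∇^1 A_{11} = h⁻¹ ∇_1̄ A_{11}`, where
`∇_1̄ A_{11} = Z_1̄ A_{11} - 2 ω_1^1(Z_1̄) A_{11}`. -/
def divA (x : M) : ℂ :=
  (D.h x : ℂ)⁻¹ * (ext (dFun D.A x) (D.Zbar x) - 2 * ext (D.conn x) (D.Zbar x) * D.A x)

/-- The `1`-form `ω_1^1 + i R θ`. -/
def curvForm : Form M ℂ 1 := fun x => D.conn x + (Complex.I * D.R x) • θ.toC x

end ContactForm.TanakaWebster

/-- `θ` is pseudo-Einstein: `∇_α R - i ∇^β A_{αβ} = 0`, in every local admissible coframe. -/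
def ContactForm.PseudoEinstein (θ : ContactForm S) : Prop :=
  ∀ (U : Set M), IsOpen U → ∀ (e : θ.AdmissibleCoframe U) (D : θ.TanakaWebster e),
    ∀ x ∈ U, D.gradR x - Complex.I * D.divA x = 0

end Pseudohermitian

end CR

end

/-!
By the first Bianchi identity and metric compatibility,
`d(ω + i R θ) = -i (E θ ∧ θ¹ + Ē θ ∧ θ^1̄)`, where `E = ∇₁ R - i ∇^1 A₁₁`.
Hence `ω + i R θ` is closed exactly when `θ` is pseudo-Einstein.

For a section `ξ = u θ ∧ θ¹` of the canonical bundle, volume normalization says `|u|² = h`, and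
`dξ = 0` says that `u⁻¹ du - ω` has no `θ^1̄` component. Since `ω + ω̄ = d log h`, it then has
no `θ¹` component either, so that `ω + i R θ = u⁻¹ du + f θ`. As `d(ω + i R θ)` is a multiple of
`θ`, the `θ¹ ∧ θ^1̄` component of its exterior derivative forces `f = 0`, and `ω + i R θ` is closed.
Conversely, a local primitive `v` of `ω + i R θ` can be chosen with real part `(log h) / 2`, and
`ξ = exp v • θ ∧ θ¹` is then closed and volume-normalized.
-/

noncomputable section

namespace CR

section PointwiseAlgebra

variable {V : Type*} [AddCommGroup V] [Module ℝ V] [TopologicalSpace V]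
variable {G : Type*} [AddCommGroup G] [Module ℝ G] [TopologicalSpace G] {k : ℕ}

theorem oneForm_ext {α β : V [⋀^Fin 1]→L[ℝ] G} (h : ∀ v, α ![v] = β ![v]) : α = β := by
  ext v
  rw [← List.ofFn_inj.1 (by simp : List.ofFn ![v 0] = List.ofFn v)]
  exact h _

theorem twoForm_ext {α β : V [⋀^Fin 2]→L[ℝ] G} (h : ∀ v w, α ![v, w] = β ![v, w]) : α = β := by
  ext v
  rw [← List.ofFn_inj.1 (by simp : List.ofFn ![v 0, v 1] = List.ofFn v)]
  exact h _ _

theorem threeForm_ext {α β : V [⋀^Fin 3]→L[ℝ] G}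
    (h : ∀ u v w, α ![u, v, w] = β ![u, v, w]) : α = β := by
  ext v
  rw [← List.ofFn_inj.1 (by simp : List.ofFn ![v 0, v 1, v 2] = List.ofFn v)]
  exact h _ _ _

theorem form_smul_zero (c : ℂ) : c • (0 : V [⋀^Fin k]→L[ℝ] ℂ) = 0 := by
  ext v; simp

theorem form_zero_smul (α : V [⋀^Fin k]→L[ℝ] ℂ) : (0 : ℂ) • α = 0 := by
  ext v; simp

theorem form_smul_eq_zero {c : ℂ} {α : V [⋀^Fin k]→L[ℝ] ℂ} : c • α = 0 ↔ c = 0 ∨ α = 0 := by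
  refine ⟨fun h => or_iff_not_imp_left.2 fun hc => ?_, ?_⟩
  · ext v
    exact (smul_eq_zero.1 (congrArg (fun β => β v) h)).resolve_left hc
  · rintro (rfl | rfl)
    exacts [form_zero_smul α, form_smul_zero c]

theorem twoForm_self (β : V [⋀^Fin 2]→L[ℝ] G) (v : V) : β ![v, v] = 0 :=
  β.map_eq_zero_of_eq ![v, v] (i := 0) (j := 1) rfl (by decide)

theorem twoForm_swap (β : V [⋀^Fin 2]→L[ℝ] G) (v w : V) : β ![v, w] = -β ![w, v] := by
  have e : ![w, v] ∘ Equiv.swap (0 : Fin 2) 1 = ![v, w] := by ext i; fin_cases i <;> simp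
  have h := β.toAlternatingMap.map_swap ![w, v] (i := 0) (j := 1) (by decide)
  rwa [e] at h

theorem wedge_one_apply (α β : V [⋀^Fin 1]→L[ℝ] ℂ) (v w : V) :
    wedge α β ![v, w] = α ![v] * β ![w] - α ![w] * β ![v] := by
  have h₀ : (0 : Fin 2).removeNth ![v, w] = ![w] := by ext i; fin_cases i; rfl
  have h₁ : (1 : Fin 2).removeNth ![v, w] = ![v] := by ext i; fin_cases i; rfl
  simp [wedge_apply, Fin.sum_univ_two, h₀, h₁, sub_eq_add_neg]

theorem wedge_two_apply (α : V [⋀^Fin 1]→L[ℝ] ℂ) (β : V [⋀^Fin 2]→L[ℝ] ℂ) (u v w : V) :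
    wedge α β ![u, v, w] = α ![u] * β ![v, w] - α ![v] * β ![u, w] + α ![w] * β ![u, v] := by
  have h₀ : (0 : Fin 3).removeNth ![u, v, w] = ![v, w] := by ext i; fin_cases i <;> rfl
  have h₁ : (1 : Fin 3).removeNth ![u, v, w] = ![u, w] := by ext i; fin_cases i <;> rfl
  have h₂ : (2 : Fin 3).removeNth ![u, v, w] = ![u, v] := by ext i; fin_cases i <;> rfl
  simp [wedge_apply, Fin.sum_univ_three, h₀, h₁, h₂, sub_eq_add_neg]

theorem wedge_add_left (α α' : V [⋀^Fin 1]→L[ℝ] ℂ) (β : V [⋀^Fin k]→L[ℝ] ℂ) :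
    wedge (α + α') β = wedge α β + wedge α' β := by
  ext v; simp [wedge_apply, add_mul, Finset.sum_add_distrib]

theorem wedge_add_right (α : V [⋀^Fin 1]→L[ℝ] ℂ) (β β' : V [⋀^Fin k]→L[ℝ] ℂ) :
    wedge α (β + β') = wedge α β + wedge α β' := by
  ext v; simp [wedge_apply, mul_add, Finset.sum_add_distrib]

theorem wedge_smul_left (c : ℂ) (α : V [⋀^Fin 1]→L[ℝ] ℂ) (β : V [⋀^Fin k]→L[ℝ] ℂ) :
    wedge (c • α) β = c • wedge α β := by
  ext v; simp [wedge_apply, Finset.mul_sum, mul_assoc, mul_left_comm]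

theorem wedge_smul_right (c : ℂ) (α : V [⋀^Fin 1]→L[ℝ] ℂ) (β : V [⋀^Fin k]→L[ℝ] ℂ) :
    wedge α (c • β) = c • wedge α β := by
  ext v; simp [wedge_apply, Finset.mul_sum, mul_left_comm]

theorem wedge_zero_right (α : V [⋀^Fin 1]→L[ℝ] ℂ) :
    wedge α (0 : V [⋀^Fin k]→L[ℝ] ℂ) = 0 := by
  ext v; simp [wedge_apply]

theorem wedge_neg_right (α : V [⋀^Fin 1]→L[ℝ] ℂ) (β : V [⋀^Fin k]→L[ℝ] ℂ) :
    wedge α (-β) = -wedge α β := by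
  ext v; simp [wedge_apply]

theorem wedge_self (α : V [⋀^Fin 1]→L[ℝ] ℂ) : wedge α α = 0 :=
  twoForm_ext fun v w => by simp [wedge_one_apply, mul_comm]

theorem wedge_swap (α β : V [⋀^Fin 1]→L[ℝ] ℂ) : wedge α β = -wedge β α :=
  twoForm_ext fun v w => by simp [wedge_one_apply, mul_comm]

theorem wedge_left_comm (α β γ : V [⋀^Fin 1]→L[ℝ] ℂ) :
    wedge α (wedge β γ) = -wedge β (wedge α γ) :=
  threeForm_ext fun u v w => by
    simp only [wedge_two_apply, wedge_one_apply, ContinuousAlternatingMap.neg_apply]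
    ring

theorem wedge_wedge_self (α β : V [⋀^Fin 1]→L[ℝ] ℂ) : wedge α (wedge α β) = 0 :=
  threeForm_ext fun u v w => by
    simp only [wedge_two_apply, wedge_one_apply, ContinuousAlternatingMap.coe_zero,
      Pi.zero_apply]
    ring

theorem conjForm_apply (β : V [⋀^Fin k]→L[ℝ] ℂ) (v : Fin k → V) :
    conjForm β v = conj (β v) := rfl

theorem ofRealForm_apply (β : V [⋀^Fin k]→L[ℝ] ℝ) (v : Fin k → V) :
    ofRealForm β v = (β v : ℂ) := rfl

theorem conjForm_add (α β : V [⋀^Fin k]→L[ℝ] ℂ) :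
    conjForm (α + β) = conjForm α + conjForm β := by ext v; simp [conjForm_apply]

theorem conjForm_smul (c : ℂ) (α : V [⋀^Fin k]→L[ℝ] ℂ) :
    conjForm (c • α) = conj c • conjForm α := by ext v; simp [conjForm_apply]

theorem conjForm_conjForm (α : V [⋀^Fin k]→L[ℝ] ℂ) : conjForm (conjForm α) = α := by
  ext v; simp [conjForm_apply]

theorem conjForm_ofRealForm (α : V [⋀^Fin k]→L[ℝ] ℝ) :
    conjForm (ofRealForm α) = ofRealForm α := by
  ext v; simp [conjForm_apply, ofRealForm_apply]

theorem conjForm_wedge (α : V [⋀^Fin 1]→L[ℝ] ℂ) (β : V [⋀^Fin k]→L[ℝ] ℂ) :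
    conjForm (wedge α β) = wedge (conjForm α) (conjForm β) := by
  ext v; simp [conjForm_apply, wedge_apply, map_sum]

theorem contract_conjForm (v : V) (β : V [⋀^Fin (k + 1)]→L[ℝ] ℂ) :
    contract v (conjForm β) = conjForm (contract v β) := rfl

theorem contract_smul (v : V) (c : ℂ) (β : V [⋀^Fin (k + 1)]→L[ℝ] ℂ) :
    contract v (c • β) = c • contract v β := rfl

theorem contract_add (v : V) (β β' : V [⋀^Fin (k + 1)]→L[ℝ] ℂ) :
    contract v (β + β') = contract v β + contract v β' := rfl

theorem contract_wedge_one (v : V) (α β : V [⋀^Fin 1]→L[ℝ] ℂ) :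
    contract v (wedge α β) = α ![v] • β - β ![v] • α :=
  oneForm_ext fun w => by
    rw [contract_apply]
    simp [wedge_one_apply, mul_comm]

theorem ext_add (α β : V [⋀^Fin 1]→L[ℝ] ℂ) (z : ℂ ⊗[ℝ] V) :
    ext (α + β) z = ext α z + ext β z := by
  induction z with
  | zero => simp
  | tmul c v => simp only [ext_tmul, ContinuousAlternatingMap.add_apply, mul_add]
  | add x y hx hy => simp only [map_add, hx, hy, add_add_add_comm]

theorem ext_smul (c : ℂ) (α : V [⋀^Fin 1]→L[ℝ] ℂ) (z : ℂ ⊗[ℝ] V) :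
    ext (c • α) z = c * ext α z := by
  induction z with
  | zero => simp
  | tmul a v =>
    simp only [ext_tmul, ContinuousAlternatingMap.smul_apply, smul_eq_mul, mul_left_comm]
  | add x y hx hy => simp only [map_add, hx, hy, mul_add]

theorem ext_sub (α β : V [⋀^Fin 1]→L[ℝ] ℂ) (z : ℂ ⊗[ℝ] V) :
    ext (α - β) z = ext α z - ext β z := by
  rw [eq_sub_iff_add_eq, ← ext_add, sub_add_cancel]

theorem ext_zero (z : ℂ ⊗[ℝ] V) : ext 0 z = 0 := by
  rw [← sub_self (0 : V [⋀^Fin 1]→L[ℝ] ℂ), ext_sub, sub_self]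

section Basis

variable (b : Module.Basis (Fin 3) ℝ V)

theorem oneForm_ext_basis {α β : V [⋀^Fin 1]→L[ℝ] G} (h : ∀ i, α ![b i] = β ![b i]) :
    α = β := by
  apply ContinuousAlternatingMap.toAlternatingMap_injective
  refine b.ext_alternating fun v _ => ?_
  have e : (fun i => b (v i)) = ![b (v 0)] := by ext i; fin_cases i; rfl
  rw [e]
  exact h _

theorem twoForm_ext_basis {α β : V [⋀^Fin 2]→L[ℝ] G}
    (h : ∀ i j, i < j → α ![b i, b j] = β ![b i, b j]) : α = β := by
  apply ContinuousAlternatingMap.toAlternatingMap_injective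
  refine b.ext_alternating fun v hv => ?_
  have e : (fun i => b (v i)) = ![b (v 0), b (v 1)] := by ext i; fin_cases i <;> rfl
  rw [e]
  rcases lt_trichotomy (v 0) (v 1) with hlt | heq | hgt
  · exact h _ _ hlt
  · exact absurd (hv heq) (by decide)
  · exact (twoForm_swap α _ _).trans
      ((congrArg Neg.neg (h _ _ hgt)).trans (twoForm_swap β _ _).symm)

theorem threeForm_ext_basis {α β : V [⋀^Fin 3]→L[ℝ] G} (h : α b = β b) : α = β := by
  apply ContinuousAlternatingMap.toAlternatingMap_injective
  refine b.ext_alternating fun v hv => ?_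
  set σ : Equiv.Perm (Fin 3) := Equiv.ofBijective v (Finite.injective_iff_bijective.1 hv)
  have e : (fun i => b (v i)) = b ∘ σ := rfl
  rw [e, AlternatingMap.map_perm, AlternatingMap.map_perm]
  exact congrArg _ h

theorem threeForm_apply_basis_ne_zero {Φ : V [⋀^Fin 3]→L[ℝ] G} (hΦ : Φ ≠ 0) : Φ b ≠ 0 :=
  fun h => hΦ (threeForm_ext_basis b h)

theorem wedge_two_apply_basis (α : V [⋀^Fin 1]→L[ℝ] ℂ) (β : V [⋀^Fin 2]→L[ℝ] ℂ) :
    wedge α β b = α ![b 0] * β ![b 1, b 2] - α ![b 1] * β ![b 0, b 2] +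
      α ![b 2] * β ![b 0, b 1] :=
  (congrArg (wedge α β) (by ext i; fin_cases i <;> rfl)).trans (wedge_two_apply α β _ _ _)

theorem oneForm_cramer (β α₀ α₁ α₂ : V [⋀^Fin 1]→L[ℝ] ℂ) :
    wedge α₀ (wedge α₁ α₂) b • β = wedge β (wedge α₁ α₂) b • α₀ +
      wedge α₀ (wedge β α₂) b • α₁ + wedge α₀ (wedge α₁ β) b • α₂ := by
  refine oneForm_ext_basis b fun i => ?_
  simp only [wedge_two_apply_basis, wedge_one_apply,
    ContinuousAlternatingMap.add_apply, ContinuousAlternatingMap.smul_apply, smul_eq_mul]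
  fin_cases i <;> simp only [Fin.zero_eta, Fin.mk_one, Fin.reduceFinMk] <;> ring

theorem twoForm_cramer (β : V [⋀^Fin 2]→L[ℝ] ℂ) (α₀ α₁ α₂ : V [⋀^Fin 1]→L[ℝ] ℂ) :
    wedge α₀ (wedge α₁ α₂) b • β = wedge α₂ β b • wedge α₀ α₁ +
      (-wedge α₁ β b) • wedge α₀ α₂ + wedge α₀ β b • wedge α₁ α₂ := by
  refine twoForm_ext_basis b fun i j hij => ?_
  simp only [wedge_two_apply_basis, wedge_one_apply,
    ContinuousAlternatingMap.add_apply, ContinuousAlternatingMap.smul_apply, smul_eq_mul]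
  fin_cases i <;> fin_cases j <;> first
  | exact absurd hij (by decide)
  | simp only [Fin.zero_eta, Fin.mk_one, Fin.reduceFinMk]; ring

variable {α₀ α₁ α₂ : V [⋀^Fin 1]→L[ℝ] ℂ}

include b in
theorem exists_oneForm_eq (β : V [⋀^Fin 1]→L[ℝ] ℂ) (h : wedge α₀ (wedge α₁ α₂) ≠ 0) :
    ∃ c₀ c₁ c₂ : ℂ, β = c₀ • α₀ + c₁ • α₁ + c₂ • α₂ := by
  have hb := threeForm_apply_basis_ne_zero b h
  have hβ := (eq_inv_smul_iff₀ hb).2 (oneForm_cramer b β α₀ α₁ α₂)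
  rw [smul_add, smul_add, smul_smul, smul_smul, smul_smul] at hβ
  exact ⟨_, _, _, hβ⟩

include b in
theorem exists_twoForm_eq (β : V [⋀^Fin 2]→L[ℝ] ℂ) (h : wedge α₀ (wedge α₁ α₂) ≠ 0) :
    ∃ c₀₁ c₀₂ c₁₂ : ℂ, β = c₀₁ • wedge α₀ α₁ + c₀₂ • wedge α₀ α₂ + c₁₂ • wedge α₁ α₂ := by
  have hb := threeForm_apply_basis_ne_zero b h
  have hβ := (eq_inv_smul_iff₀ hb).2 (twoForm_cramer b β α₀ α₁ α₂)
  rw [smul_add, smul_add, smul_smul, smul_smul, smul_smul] at hβ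
  exact ⟨_, _, _, hβ⟩

end Basis

end PointwiseAlgebra

section FlatCalculus

variable {E F G : Type*} [NormedAddCommGroup E] [NormedSpace ℝ E] [NormedAddCommGroup F]
  [NormedSpace ℝ F] [NormedAddCommGroup G] [NormedSpace ℝ G] {k : ℕ} {n : WithTop ℕ∞} {y₀ : E}

theorem contDiffAt_form_apply {γ : E → E [⋀^Fin k]→L[ℝ] F} (hγ : ContDiffAt ℝ n γ y₀)
    (v : Fin k → E) : ContDiffAt ℝ n (fun y => γ y v) y₀ :=
  (ContinuousAlternatingMap.apply ℝ E F v).contDiff.contDiffAt.comp y₀ hγ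

theorem contDiffAt_compContinuousAlternatingMap (L : F →L[ℝ] G) {γ : E → E [⋀^Fin k]→L[ℝ] F}
    (hγ : ContDiffAt ℝ n γ y₀) :
    ContDiffAt ℝ n (fun y => L.compContinuousAlternatingMap (γ y)) y₀ :=
  (ContinuousLinearMap.compContinuousAlternatingMapCLM ℝ E F G (Fin k) L).contDiff.contDiffAt.comp
    y₀ hγ

theorem contDiffAt_extDeriv {γ : E → E [⋀^Fin k]→L[ℝ] F} (hγ : ContDiffAt ℝ ∞ γ y₀) :
    ContDiffAt ℝ ∞ (extDeriv γ) y₀ := by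
  have hd : extDeriv γ = ContinuousAlternatingMap.alternatizeUncurryFinCLM ℝ E F ∘ fderiv ℝ γ :=
    funext fun y => (ContinuousAlternatingMap.alternatizeUncurryFinCLM_apply _).symm
  rw [hd]
  exact (ContinuousLinearMap.contDiff _).contDiffAt.comp y₀ (hγ.fderiv_right (m := ∞) (by simp))

theorem norm_wedge_le (α : E [⋀^Fin 1]→L[ℝ] ℂ) (β : E [⋀^Fin k]→L[ℝ] ℂ) :
    ‖wedge α β‖ ≤ (k + 1) * ‖α‖ * ‖β‖ := by
  refine ContinuousAlternatingMap.opNorm_le_bound _ (by positivity) fun v => ?_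
  have hterm : ∀ i : Fin (k + 1), ‖(-1 : ℤ) ^ (i : ℕ) • (α ![v i] * β (i.removeNth v))‖ ≤
      ‖α‖ * ‖β‖ * ∏ j, ‖v j‖ := fun i => by
    have hα := α.le_opNorm ![v i]
    have hβ := β.le_opNorm (i.removeNth v)
    rw [← Int.cast_smul_eq_zsmul ℝ, norm_smul, Fin.prod_univ_succAbove _ i]
    simp only [Int.cast_pow, Int.cast_neg, Int.cast_one, norm_pow, norm_neg, norm_one, one_pow,
      one_mul, norm_mul]
    calc _ ≤ (‖α‖ * ∏ j, ‖![v i] j‖) * (‖β‖ * ∏ j, ‖i.removeNth v j‖) := by gcongr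
      _ = _ := by
        simp only [Finset.univ_unique, Matrix.cons_val_fin_one, Finset.prod_const,
          Finset.card_singleton, pow_one, Fin.removeNth]
        ring
  rw [wedge_apply]
  refine (norm_sum_le_of_le _ fun i _ => hterm i).trans_eq ?_
  simp only [Finset.sum_const, Finset.card_univ, Fintype.card_fin, nsmul_eq_mul, Nat.cast_add,
    Nat.cast_one]
  ring

theorem isBoundedBilinearMap_wedge : IsBoundedBilinearMap ℝ
    fun p : (E [⋀^Fin 1]→L[ℝ] ℂ) × (E [⋀^Fin k]→L[ℝ] ℂ) => wedge p.1 p.2 where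
  add_left := wedge_add_left
  add_right := wedge_add_right
  smul_left c α β := wedge_smul_left (c : ℂ) α β
  smul_right c α β := wedge_smul_right (c : ℂ) α β
  bound := ⟨k + 1, by positivity, norm_wedge_le⟩

theorem contDiffAt_wedge {α : E → E [⋀^Fin 1]→L[ℝ] ℂ} {β : E → E [⋀^Fin k]→L[ℝ] ℂ}
    (hα : ContDiffAt ℝ n α y₀) (hβ : ContDiffAt ℝ n β y₀) :
    ContDiffAt ℝ n (fun y => wedge (α y) (β y)) y₀ := by
  have hw := (isBoundedBilinearMap_wedge (E := E) (k := k)).contDiff (n := n)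
  have hcomp := (hw.contDiffAt (x := (α y₀, β y₀))).comp y₀ (hα.prodMk hβ)
  exact hcomp

theorem differentiableAt_wedge {α : E → E [⋀^Fin 1]→L[ℝ] ℂ} {β : E → E [⋀^Fin k]→L[ℝ] ℂ}
    (hα : DifferentiableAt ℝ α y₀) (hβ : DifferentiableAt ℝ β y₀) :
    DifferentiableAt ℝ (fun y => wedge (α y) (β y)) y₀ := by
  have hw := (isBoundedBilinearMap_wedge (E := E) (k := k)).differentiableAt (α y₀, β y₀)
  have hcomp := hw.comp y₀ (hα.prodMk hβ)
  exact hcomp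

theorem extDeriv_one_apply {γ : E → E [⋀^Fin 1]→L[ℝ] F} (hγ : DifferentiableAt ℝ γ y₀)
    (v w : E) : extDeriv γ y₀ ![v, w] =
      fderiv ℝ (fun y => γ y ![w]) y₀ v - fderiv ℝ (fun y => γ y ![v]) y₀ w := by
  have h₀ : (0 : Fin 2).removeNth ![v, w] = ![w] := by ext i; fin_cases i; rfl
  have h₁ : (1 : Fin 2).removeNth ![v, w] = ![v] := by ext i; fin_cases i; rfl
  simp [extDeriv_apply hγ, Fin.sum_univ_two, h₀, h₁, sub_eq_add_neg]

theorem extDeriv_two_apply {γ : E → E [⋀^Fin 2]→L[ℝ] F} (hγ : DifferentiableAt ℝ γ y₀)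
    (u v w : E) : extDeriv γ y₀ ![u, v, w] =
      fderiv ℝ (fun y => γ y ![v, w]) y₀ u - fderiv ℝ (fun y => γ y ![u, w]) y₀ v +
        fderiv ℝ (fun y => γ y ![u, v]) y₀ w := by
  have h₀ : (0 : Fin 3).removeNth ![u, v, w] = ![v, w] := by ext i; fin_cases i <;> rfl
  have h₁ : (1 : Fin 3).removeNth ![u, v, w] = ![u, w] := by ext i; fin_cases i <;> rfl
  have h₂ : (2 : Fin 3).removeNth ![u, v, w] = ![u, v] := by ext i; fin_cases i <;> rfl
  simp [extDeriv_apply hγ, Fin.sum_univ_three, h₀, h₁, h₂, sub_eq_add_neg]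

theorem fderiv_wedge_one_apply {α β : E → E [⋀^Fin 1]→L[ℝ] ℂ} (hα : DifferentiableAt ℝ α y₀)
    (hβ : DifferentiableAt ℝ β y₀) (u v w : E) :
    fderiv ℝ (fun y => wedge (α y) (β y) ![v, w]) y₀ u =
      α y₀ ![v] * fderiv ℝ (fun y => β y ![w]) y₀ u +
        fderiv ℝ (fun y => α y ![v]) y₀ u * β y₀ ![w] -
      (α y₀ ![w] * fderiv ℝ (fun y => β y ![v]) y₀ u +
        fderiv ℝ (fun y => α y ![w]) y₀ u * β y₀ ![v]) := by
  have hα' := fun v => hα.continuousAlternatingMap_apply_const ![v]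
  have hβ' := fun v => hβ.continuousAlternatingMap_apply_const ![v]
  simp only [wedge_one_apply]
  rw [fderiv_fun_sub ((hα' v).fun_mul (hβ' w)) ((hα' w).fun_mul (hβ' v)),
    fderiv_fun_mul (hα' v) (hβ' w), fderiv_fun_mul (hα' w) (hβ' v)]
  simp only [_root_.sub_apply, _root_.add_apply, _root_.smul_apply, smul_eq_mul,
    mul_comm (β y₀ _)]

theorem extDeriv_wedge {α β : E → E [⋀^Fin 1]→L[ℝ] ℂ} (hα : DifferentiableAt ℝ α y₀)
    (hβ : DifferentiableAt ℝ β y₀) :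
    extDeriv (fun y => wedge (α y) (β y)) y₀ =
      wedge (β y₀) (extDeriv α y₀) - wedge (α y₀) (extDeriv β y₀) := by
  refine threeForm_ext fun u v w => ?_
  rw [extDeriv_two_apply (differentiableAt_wedge hα hβ)]
  simp only [fderiv_wedge_one_apply hα hβ, ContinuousAlternatingMap.sub_apply,
    wedge_two_apply, extDeriv_one_apply hα, extDeriv_one_apply hβ]
  ring

theorem extDeriv_function_smul {f : E → ℂ} {γ : E → E [⋀^Fin k]→L[ℝ] ℂ}
    (hf : DifferentiableAt ℝ f y₀) (hγ : DifferentiableAt ℝ γ y₀) :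
    extDeriv (fun y => f y • γ y) y₀ =
      wedge (ContinuousAlternatingMap.ofSubsingleton ℝ E ℂ (0 : Fin 1) (fderiv ℝ f y₀)) (γ y₀) +
        f y₀ • extDeriv γ y₀ := by
  ext v
  rw [extDeriv_apply (hf.fun_smul hγ), ContinuousAlternatingMap.add_apply, wedge_apply,
    ContinuousAlternatingMap.smul_apply, extDeriv_apply hγ, Finset.smul_sum,
    ← Finset.sum_add_distrib]
  refine Finset.sum_congr rfl fun i _ => ?_
  have hγi := hγ.continuousAlternatingMap_apply_const (i.removeNth v)
  simp only [ContinuousAlternatingMap.smul_apply, smul_eq_mul]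
  rw [fderiv_fun_mul hf hγi, mul_smul_comm, ← smul_add]
  simp [mul_comm, add_comm]

theorem extDeriv_compContinuousAlternatingMap (L : F →L[ℝ] G) {γ : E → E [⋀^Fin k]→L[ℝ] F}
    (hγ : DifferentiableAt ℝ γ y₀) :
    extDeriv (fun y => L.compContinuousAlternatingMap (γ y)) y₀ =
      L.compContinuousAlternatingMap (extDeriv γ y₀) := by
  have hL : DifferentiableAt ℝ (fun y => L.compContinuousAlternatingMap (γ y)) y₀ :=
    (ContinuousLinearMap.compContinuousAlternatingMapCLM ℝ E F G (Fin k)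
      L).differentiableAt.comp y₀ hγ
  ext v
  rw [extDeriv_apply hL, ContinuousLinearMap.compContinuousAlternatingMap_coe,
    Function.comp_apply, extDeriv_apply hγ, map_sum]
  refine Finset.sum_congr rfl fun i _ => ?_
  have hγi := hγ.continuousAlternatingMap_apply_const (i.removeNth v)
  have hLi := (L.hasFDerivAt.comp y₀ hγi.hasFDerivAt).fderiv
  rw [map_zsmul]
  exact congrArg _ (DFunLike.congr_fun hLi (v i))

theorem form_apply_eq_sum {ι : Type*} [Fintype ι] (b : Module.Basis ι ℝ E)
    (α : E [⋀^Fin k]→L[ℝ] F) (v : Fin k → E) :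
    α v = ∑ r : Fin k → ι, (∏ i, b.coord (r i) (v i)) • α fun i => b (r i) := by
  conv_lhs => rw [show v = fun i => ∑ j, b.coord j (v i) • b j from
    funext fun i => (b.sum_repr (v i)).symm]
  rw [α.map_sum]
  exact Finset.sum_congr rfl fun r _ => α.map_smul_univ _ _

theorem exists_hasFDerivAt_of_extDeriv_eq_zero [CompleteSpace F] {s : Set E} (hs : Convex ℝ s)
    (hso : IsOpen s) {γ : E → E [⋀^Fin 1]→L[ℝ] F} (hγ : DifferentiableOn ℝ γ s)
    (hd : ∀ y ∈ s, extDeriv γ y = 0) :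
    ∃ f : E → F, ∀ y ∈ s,
      HasFDerivAt f ((ContinuousAlternatingMap.ofSubsingleton ℝ E F (0 : Fin 1)).symm (γ y)) y := by
  let g : (E [⋀^Fin 1]→L[ℝ] F) ≃ₗᵢ[ℝ] (E →L[ℝ] F) :=
    (ContinuousAlternatingMap.ofSubsingletonLIE (0 : Fin 1)).symm
  refine hs.exists_forall_hasFDerivAt_of_fderiv_symmetric hso
    (g.differentiable.comp_differentiableOn hγ) fun y hy v w => ?_
  have hγy := hγ.differentiableAt (hso.mem_nhds hy)
  have hg : ∀ v w, fderiv ℝ (g ∘ γ) y v w = fderiv ℝ (fun z => γ z ![w]) y v := fun v w => by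
    have hgw : ∀ z, (g ∘ γ) z w = γ z ![w] := fun z =>
      congrArg (γ z) (by ext i; fin_cases i; rfl)
    have happly := ((g.differentiable.differentiableAt.comp y hγy).hasFDerivAt.clm_apply
      (hasFDerivAt_const w y)).fderiv
    simp only [hgw] at happly
    simp [happly]
  have hsymm := extDeriv_one_apply hγy v w
  rw [hd y hy, ← hg, ← hg] at hsymm
  exact sub_eq_zero.1 hsymm.symm

section FiniteDimensional

variable [FiniteDimensional ℝ E]

theorem contDiffAt_form_apply_apply {γ : E → E [⋀^Fin k]→L[ℝ] F} (hγ : ContDiffAt ℝ n γ y₀)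
    {v : Fin k → E → E} (hv : ∀ i, ContDiffAt ℝ n (v i) y₀) :
    ContDiffAt ℝ n (fun y => γ y fun i => v i y) y₀ := by
  simp_rw [fun y => form_apply_eq_sum (Module.finBasis ℝ E) (γ y) fun i => v i y]
  refine ContDiffAt.sum fun r _ => ContDiffAt.smul (contDiffAt_prod fun i _ => ?_)
    (contDiffAt_form_apply hγ _)
  exact (LinearMap.toContinuousLinearMap ((Module.finBasis ℝ E).coord (r i))).contDiff.contDiffAt
    |>.comp y₀ (hv i)

variable [FiniteDimensional ℝ F]

theorem contDiffAt_form_iff {γ : E → E [⋀^Fin k]→L[ℝ] F} :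
    ContDiffAt ℝ n γ y₀ ↔ ∀ v : Fin k → E, ContDiffAt ℝ n (fun y => γ y v) y₀ := by
  refine ⟨contDiffAt_form_apply, fun h => ?_⟩
  let b := Module.finBasis ℝ E
  let L : (E [⋀^Fin k]→L[ℝ] F) →ₗ[ℝ] (Fin k → Fin (Module.finrank ℝ E)) → F :=
    LinearMap.pi fun r => (ContinuousAlternatingMap.apply ℝ E F fun i => b (r i)).toLinearMap
  have hL : LinearMap.ker L = ⊥ := LinearMap.ker_eq_bot'.2 fun α hα => by
    ext v
    rw [form_apply_eq_sum b]
    refine Finset.sum_eq_zero fun r _ => ?_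
    rw [show α (fun i => b (r i)) = 0 from congrFun hα r, smul_zero]
  obtain ⟨g, hg⟩ := L.exists_leftInverse_of_injective hL
  have hγ : γ = fun y => LinearMap.toContinuousLinearMap g (L (γ y)) :=
    funext fun y => (LinearMap.congr_fun hg (γ y)).symm
  rw [hγ]
  exact (LinearMap.toContinuousLinearMap g).contDiff.contDiffAt.comp y₀
    (contDiffAt_pi.2 fun r => h fun i => b (r i))

theorem contDiffAt_pullback {γ : E → E [⋀^Fin k]→L[ℝ] F} {τ : E → E}
    (hγ : ContDiffAt ℝ ∞ γ (τ y₀)) (hτ : ContDiffAt ℝ ∞ τ y₀) :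
    ContDiffAt ℝ ∞ (fun y => (γ (τ y)).compContinuousLinearMap (fderiv ℝ τ y)) y₀ :=
  contDiffAt_form_iff.2 fun _ => contDiffAt_form_apply_apply (hγ.comp y₀ hτ) fun _ =>
    (hτ.fderiv_right (m := ∞) (by simp)).clm_apply contDiffAt_const

end FiniteDimensional

theorem minSmoothness_two_le_infty : minSmoothness ℝ 2 ≤ (∞ : WithTop ℕ∞) := by
  rw [minSmoothness_of_isRCLikeNormedField]
  exact WithTop.coe_le_coe.2 le_top

end FlatCalculus

section ChartCalculus

open Filter Topology

variable {M : Type*} [TopologicalSpace M] [ChartedSpace E3 M]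
variable {F : Type*} [NormedAddCommGroup F] [NormedSpace ℝ F] {k : ℕ} {p q : M} {y : E3}

theorem form_congr_point (β : Form M F k) (h : p = q) {v w : Fin k → E3} (hvw : v = w) :
    (show E3 [⋀^Fin k]→L[ℝ] F from β p) v = (show E3 [⋀^Fin k]→L[ℝ] F from β q) w := by
  subst h; subst hvw; rfl

/-- The preferred chart of `M` at `p`, as a map to the model space. -/
abbrev chartMap (p : M) : M → E3 := extChartAt (𝓡 3) p

/-- The inverse of the preferred chart of `M` at `p`. -/
abbrev chartInv (p : M) : E3 → M := (extChartAt (𝓡 3) p).symm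

theorem chartInv_chartMap (hq : q ∈ (extChartAt (𝓡 3) p).source) :
    chartInv p (chartMap p q) = q := (extChartAt (𝓡 3) p).left_inv hq

theorem chartInv_chartMap_self (p : M) : chartInv p (chartMap p p) = p :=
  chartInv_chartMap (mem_extChartAt_source p)

theorem chartMap_chartInv (hy : y ∈ (extChartAt (𝓡 3) p).target) :
    chartMap p (chartInv p y) = y := (extChartAt (𝓡 3) p).right_inv hy

theorem eventually_mem_target (hy : y ∈ (extChartAt (𝓡 3) p).target) :
    ∀ᶠ z in 𝓝 y, z ∈ (extChartAt (𝓡 3) p).target :=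
  (isOpen_extChartAt_target p).mem_nhds hy

theorem eventually_chartInv (hy : y ∈ (extChartAt (𝓡 3) p).target) {P : M → Prop}
    (h : ∀ᶠ x in 𝓝 (chartInv p y), P x) : ∀ᶠ z in 𝓝 y, P (chartInv p z) :=
  (continuousAt_extChartAt_symm'' hy).eventually h

theorem eventually_chartInv_self {P : M → Prop} (h : ∀ᶠ x in 𝓝 p, P x) :
    ∀ᶠ z in 𝓝 (chartMap p p), P (chartInv p z) :=
  eventually_chartInv (mem_extChartAt_target p) (by rwa [chartInv_chartMap_self])

/-- The derivative of the chart at `p`, at a point `q` of its domain, in terms of the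
identification of tangent spaces of `M` with the model space. -/
def chartD (p q : M) : E3 →L[ℝ] E3 := mfderiv (𝓡 3) 𝓘(ℝ, E3) (chartMap p) q

/-- The derivative of the inverse of the chart at `p`. -/
def chartInvD (p : M) (y : E3) : E3 →L[ℝ] E3 := mfderiv 𝓘(ℝ, E3) (𝓡 3) (chartInv p) y

theorem inChart_apply (β : Form M F k) (p : M) (y : E3) (v : Fin k → E3) :
    Form.inChart β p y v =
      (show E3 [⋀^Fin k]→L[ℝ] F from β (chartInv p y)) fun i => chartInvD p y (v i) := rfl

theorem inChart_congr {β γ : Form M F k} (h : ∀ᶠ x in 𝓝 p, β x = γ x) :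
    Form.inChart β p =ᶠ[𝓝 (chartMap p p)] Form.inChart γ p :=
  (eventually_chartInv_self h).mono fun z hz => by
    ext v
    rw [inChart_apply, inChart_apply, hz]

theorem d_congr {β γ : Form M F k} (h : ∀ᶠ x in 𝓝 p, β x = γ x) : Form.d β p = Form.d γ p := by
  rw [Form.d, Form.d, (inChart_congr h).extDeriv_eq]

/-- A form is smooth at `p` if its expression in the preferred chart at `p` is. -/
def Form.SmoothAt (β : Form M F k) (p : M) : Prop :=
  ContDiffAt ℝ ∞ (Form.inChart β p) (chartMap p p)

theorem Form.SmoothAt.differentiableAt {β : Form M F k} (h : Form.SmoothAt β p) :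
    DifferentiableAt ℝ (Form.inChart β p) (chartMap p p) :=
  ContDiffAt.differentiableAt h (by simp)

theorem Form.SmoothAt.congr {β γ : Form M F k} (h : ∀ᶠ x in 𝓝 p, β x = γ x)
    (hγ : Form.SmoothAt γ p) : Form.SmoothAt β p :=
  ContDiffAt.congr_of_eventuallyEq hγ (inChart_congr h)

variable [IsManifold (𝓡 3) ∞ M]

theorem mdifferentiableAt_chartInv (hy : y ∈ (extChartAt (𝓡 3) p).target) :
    MDifferentiableAt 𝓘(ℝ, E3) (𝓡 3) (chartInv p) y := by
  have h := mdifferentiableWithinAt_extChartAt_symm (I := 𝓡 3) hy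
  rwa [ModelWithCorners.range_eq_univ, mdifferentiableWithinAt_univ] at h

theorem mdifferentiableAt_chartMap (hq : q ∈ (extChartAt (𝓡 3) p).source) :
    MDifferentiableAt (𝓡 3) 𝓘(ℝ, E3) (chartMap p) q :=
  mdifferentiableAt_extChartAt (by rwa [extChartAt_source] at hq)

theorem chartInvD_chartD (hq : q ∈ (extChartAt (𝓡 3) p).source) (v : E3) :
    chartInvD p (chartMap p q) (chartD p q v) = v := by
  have h := mfderivWithin_extChartAt_symm_comp_mfderiv_extChartAt' (I := 𝓡 3) hq
  rw [ModelWithCorners.range_eq_univ, mfderivWithin_univ] at h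
  exact DFunLike.congr_fun h v

theorem chartD_chartInvD (hy : y ∈ (extChartAt (𝓡 3) p).target) (v : E3) :
    chartD p (chartInv p y) (chartInvD p y v) = v := by
  have h := mfderiv_extChartAt_comp_mfderivWithin_extChartAt_symm (I := 𝓡 3) hy
  rw [ModelWithCorners.range_eq_univ, mfderivWithin_univ] at h
  exact DFunLike.congr_fun h v

theorem chartD_self (p : M) (v : E3) : chartD p p v = v :=
  DFunLike.congr_fun (mfderiv_extChartAt_self (I := 𝓡 3) (x := p)) v

theorem chartInvD_self (p : M) (v : E3) : chartInvD p (chartMap p p) v = v := by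
  conv_lhs => rw [← chartD_self p v]
  exact chartInvD_chartD (mem_extChartAt_source p) v

theorem inChart_self (β : Form M F k) (p : M) :
    Form.inChart β p (chartMap p p) = (show E3 [⋀^Fin k]→L[ℝ] F from β p) := by
  ext v
  rw [inChart_apply]
  exact form_congr_point β (chartInv_chartMap_self p) (funext fun i => chartInvD_self p _)

theorem d_eq_extDeriv (β : Form M F k) (p : M) :
    (show E3 [⋀^Fin (k + 1)]→L[ℝ] F from Form.d β p) =
      extDeriv (Form.inChart β p) (chartMap p p) := by
  ext v
  change extDeriv (Form.inChart β p) (chartMap p p) (fun i => chartD p p (v i)) = _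
  simp only [chartD_self]

/-- The change of coordinates from the chart at `p` to the chart at `q`. -/
def transition (p q : M) : E3 → E3 := chartMap q ∘ chartInv p

theorem contDiffAt_transition (hy : y ∈ (extChartAt (𝓡 3) p).target)
    (hq : chartInv p y ∈ (extChartAt (𝓡 3) q).source) :
    ContDiffAt ℝ ∞ (transition p q) y := by
  have h := contDiffWithinAt_ext_coord_change (n := ∞) (I := 𝓡 3) q p (y := y) ⟨hy, hq⟩
  rwa [ModelWithCorners.range_eq_univ, contDiffWithinAt_univ] at h

theorem fderiv_transition (hy : y ∈ (extChartAt (𝓡 3) p).target)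
    (hq : chartInv p y ∈ (extChartAt (𝓡 3) q).source) (v : E3) :
    fderiv ℝ (transition p q) y v = chartD q (chartInv p y) (chartInvD p y v) := by
  rw [← mfderiv_eq_fderiv, transition, mfderiv_comp y (mdifferentiableAt_chartMap hq)
    (mdifferentiableAt_chartInv hy)]
  rfl

theorem inChart_eq_pullback (β : Form M F k) (hy : y ∈ (extChartAt (𝓡 3) p).target)
    (hq : chartInv p y ∈ (extChartAt (𝓡 3) q).source) :
    Form.inChart β p y = (Form.inChart β q (transition p q y)).compContinuousLinearMap
      (fderiv ℝ (transition p q) y) := by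
  ext v
  rw [ContinuousAlternatingMap.compContinuousLinearMap_apply, inChart_apply, inChart_apply]
  refine form_congr_point β (chartInv_chartMap hq).symm (funext fun i => ?_)
  rw [Function.comp_apply, fderiv_transition hy hq]
  exact (chartInvD_chartD hq _).symm

theorem inChart_eventuallyEq_pullback (β : Form M F k) (hy : y ∈ (extChartAt (𝓡 3) p).target)
    (hq : chartInv p y ∈ (extChartAt (𝓡 3) q).source) :
    Form.inChart β p =ᶠ[𝓝 y] fun z => (Form.inChart β q (transition p q z)).compContinuousLinearMap
      (fderiv ℝ (transition p q) z) := by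
  filter_upwards [eventually_mem_target hy,
    eventually_chartInv hy ((isOpen_extChartAt_source q).mem_nhds hq)] with z hz hzq
  exact inChart_eq_pullback β hz hzq

/-- `Form.d` uses a different chart at each point; the results agree because `extDeriv` commutes
with pullback along the transition maps. -/
theorem inChart_d {β : Form M F k} (hy : y ∈ (extChartAt (𝓡 3) p).target)
    (h : DifferentiableAt ℝ (Form.inChart β p) y) :
    Form.inChart (Form.d β) p y = extDeriv (Form.inChart β p) y := by
  set q := chartInv p y with hq
  have hqp : q ∈ (extChartAt (𝓡 3) p).source := (extChartAt (𝓡 3) p).map_target hy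
  have hqq : chartInv q (chartMap q q) = q := chartInv_chartMap_self q
  have hqp' : chartInv q (chartMap q q) ∈ (extChartAt (𝓡 3) p).source := by rwa [hqq]
  have hty : transition q p (chartMap q q) = y := by
    rw [transition, Function.comp_apply, hqq, chartMap_chartInv hy]
  ext v
  have hdq : extDeriv (Form.inChart β q) (chartMap q q) =
      (extDeriv (Form.inChart β p) y).compContinuousLinearMap
        (fderiv ℝ (transition q p) (chartMap q q)) := by
    rw [(inChart_eventuallyEq_pullback β (mem_extChartAt_target q) hqp').extDeriv_eq,
      extDeriv_pullback (r := ∞) (by rwa [hty])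
        (contDiffAt_transition (mem_extChartAt_target q) hqp') minSmoothness_two_le_infty, hty]
  rw [inChart_apply, ← hq, d_eq_extDeriv, hdq,
    ContinuousAlternatingMap.compContinuousLinearMap_apply]
  congr 1
  ext1 i
  rw [Function.comp_apply, fderiv_transition (mem_extChartAt_target q) hqp', chartInvD_self, hqq]
  exact chartD_chartInvD hy _

theorem Form.SmoothAt.inChart_d_eventuallyEq {β : Form M F k} (h : Form.SmoothAt β p) :
    Form.inChart (Form.d β) p =ᶠ[𝓝 (chartMap p p)] extDeriv (Form.inChart β p) := by
  filter_upwards [eventually_mem_target (mem_extChartAt_target p),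
    (ContDiffAt.of_le h (by simp : (1 : WithTop ℕ∞) ≤ ∞)).eventually (by simp)] with z hz hβz
  exact inChart_d hz (hβz.differentiableAt (by simp))

theorem Form.SmoothAt.d {β : Form M F k} (h : Form.SmoothAt β p) : Form.SmoothAt (Form.d β) p :=
  (contDiffAt_extDeriv h).congr_of_eventuallyEq h.inChart_d_eventuallyEq

theorem d_d {β : Form M F k} (h : Form.SmoothAt β p) : Form.d (Form.d β) p = 0 := by
  refine (d_eq_extDeriv _ p).trans ?_
  rw [h.inChart_d_eventuallyEq.extDeriv_eq]
  exact extDeriv_extDeriv_apply h minSmoothness_two_le_infty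

theorem Form.SmoothAt.contDiffAt_inChart [FiniteDimensional ℝ F] {β : Form M F k}
    (hy : y ∈ (extChartAt (𝓡 3) p).target) (h : Form.SmoothAt β (chartInv p y)) :
    ContDiffAt ℝ ∞ (Form.inChart β p) y :=
  have hq := mem_extChartAt_source (I := 𝓡 3) (chartInv p y)
  (contDiffAt_pullback (τ := transition p (chartInv p y)) h
    (contDiffAt_transition hy hq)).congr_of_eventuallyEq (inChart_eventuallyEq_pullback β hy hq)

end ChartCalculus

section Functions

open Filter Topology

variable {M : Type*} [TopologicalSpace M] [ChartedSpace E3 M] {f g : M → ℂ} {p : M} {y : E3}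

/-- A complex-valued function that is smooth at `p`. -/
abbrev FunSmoothAt (f : M → ℂ) (p : M) : Prop := ContMDiffAt (𝓡 3) 𝓘(ℝ, ℂ) ∞ f p

theorem funSmoothOn_iff {U : Set M} (hU : IsOpen U) :
    FunSmoothOn f U ↔ ∀ p ∈ U, FunSmoothAt f p :=
  ⟨fun h p hp => (h p hp).contMDiffAt (hU.mem_nhds hp), fun h p hp => (h p hp).contMDiffWithinAt⟩

theorem FunSmoothAt.mdifferentiableAt (hf : FunSmoothAt f p) :
    MDifferentiableAt (𝓡 3) 𝓘(ℝ, ℂ) f p := ContMDiffAt.mdifferentiableAt hf (by simp)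

theorem FunSmoothAt.const (c : ℂ) (p : M) : FunSmoothAt (fun _ => c) p := contMDiffAt_const

theorem FunSmoothAt.neg (hf : FunSmoothAt f p) : FunSmoothAt (fun x => -f x) p :=
  ContMDiffAt.neg hf

theorem FunSmoothAt.add (hf : FunSmoothAt f p) (hg : FunSmoothAt g p) :
    FunSmoothAt (fun x => f x + g x) p := ContMDiffAt.add hf hg

theorem FunSmoothAt.sub (hf : FunSmoothAt f p) (hg : FunSmoothAt g p) :
    FunSmoothAt (fun x => f x - g x) p := ContMDiffAt.sub hf hg

theorem FunSmoothAt.mul (hf : FunSmoothAt f p) (hg : FunSmoothAt g p) :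
    FunSmoothAt (fun x => f x * g x) p :=
  (contDiff_mul (𝕜 := ℝ) (𝔸 := ℂ)).contMDiff.contMDiffAt.comp p (ContMDiffAt.prodMk_space hf hg)

theorem FunSmoothAt.conj (hf : FunSmoothAt f p) : FunSmoothAt (fun x => conj (f x)) p :=
  Complex.conjCLE.contDiff.contDiffAt.comp_contMDiffAt hf

theorem FunSmoothAt.inv (hf : FunSmoothAt f p) (h0 : f p ≠ 0) :
    FunSmoothAt (fun x => (f x)⁻¹) p :=
  (contDiffAt_inv ℝ h0).comp_contMDiffAt hf

theorem FunSmoothAt.of_chart (h : ContDiffAt ℝ ∞ (f ∘ chartInv p) (chartMap p p)) :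
    FunSmoothAt f p := by
  refine (h.contMDiffAt.comp p contMDiffAt_extChartAt).congr_of_eventuallyEq ?_
  filter_upwards [extChartAt_source_mem_nhds (I := 𝓡 3) p] with x hx
  rw [Function.comp_apply, Function.comp_apply, chartInv_chartMap hx]

theorem dFun_congr (h : f =ᶠ[𝓝 p] g) : dFun f p = dFun g p := by
  rw [dFun, dFun, h.mfderiv_eq]

theorem dFun_const (c : ℂ) (p : M) : dFun (fun _ : M => c) p = 0 := by
  rw [dFun, mfderiv_const]
  rfl

theorem dFun_comp {φ : ℂ → ℂ} {L : ℂ →L[ℝ] ℂ} (hφ : HasFDerivAt φ L (f p))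
    (hf : MDifferentiableAt (𝓡 3) 𝓘(ℝ, ℂ) f p) :
    dFun (φ ∘ f) p = L.compContinuousAlternatingMap (dFun f p) := by
  rw [dFun, (hφ.hasMFDerivAt.comp p hf.hasMFDerivAt).mfderiv]
  rfl

theorem dFun_comp_of_hasDerivAt {φ : ℂ → ℂ} {c : ℂ} (hφ : HasDerivAt φ c (f p))
    (hf : MDifferentiableAt (𝓡 3) 𝓘(ℝ, ℂ) f p) :
    dFun (φ ∘ f) p = c • dFun f p := by
  rw [dFun_comp (hφ.hasFDerivAt.restrictScalars ℝ) hf]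
  ext v
  exact mul_comm _ _

theorem dFun_conj (hf : MDifferentiableAt (𝓡 3) 𝓘(ℝ, ℂ) f p) :
    dFun (fun x => conj (f x)) p = conjForm (dFun f p) :=
  dFun_comp Complex.conjCLE.hasFDerivAt hf

theorem dFun_add (hf : MDifferentiableAt (𝓡 3) 𝓘(ℝ, ℂ) f p)
    (hg : MDifferentiableAt (𝓡 3) 𝓘(ℝ, ℂ) g p) :
    dFun (fun x => f x + g x) p = dFun f p + dFun g p := by
  rw [dFun, show (fun x => f x + g x) = f + g from rfl, mfderiv_add hf hg]
  rfl

theorem dFun_sub (hf : MDifferentiableAt (𝓡 3) 𝓘(ℝ, ℂ) f p)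
    (hg : MDifferentiableAt (𝓡 3) 𝓘(ℝ, ℂ) g p) :
    dFun (fun x => f x - g x) p = dFun f p - dFun g p := by
  rw [dFun, show (fun x => f x - g x) = f - g from rfl, mfderiv_sub hf hg]
  rfl

theorem dFun_mul (hf : MDifferentiableAt (𝓡 3) 𝓘(ℝ, ℂ) f p)
    (hg : MDifferentiableAt (𝓡 3) 𝓘(ℝ, ℂ) g p) :
    dFun (fun x => f x * g x) p = f p • dFun g p + g p • dFun f p := by
  rw [dFun, show (fun x => f x * g x) = f * g from rfl,
    (hf.hasMFDerivAt.mul hg.hasMFDerivAt).mfderiv]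
  rfl

/-- The function `f` as a `0`-form. -/
def Form.ofFun (f : M → ℂ) : Form M ℂ 0 := fun x =>
  ContinuousAlternatingMap.constOfIsEmpty ℝ (TangentSpace (𝓡 3) x) (Fin 0) (f x)

theorem inChart_ofFun (f : M → ℂ) (p : M) : Form.inChart (Form.ofFun f) p =
    fun y => ContinuousAlternatingMap.constOfIsEmpty ℝ E3 (Fin 0) (f (chartInv p y)) := rfl

variable [IsManifold (𝓡 3) ∞ M]

theorem FunSmoothAt.contDiffAt_comp_chartInv (hy : y ∈ (extChartAt (𝓡 3) p).target)
    (h : FunSmoothAt f (chartInv p y)) : ContDiffAt ℝ ∞ (f ∘ chartInv p) y := by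
  have hinv := contMDiffWithinAt_extChartAt_symm_range (I := 𝓡 3) (n := ∞) p hy
  rw [ModelWithCorners.range_eq_univ, contMDiffWithinAt_univ] at hinv
  exact (ContMDiffAt.comp y h hinv).contDiffAt

theorem FunSmoothAt.contDiffAt_comp_chartInv_self (h : FunSmoothAt f p) :
    ContDiffAt ℝ ∞ (f ∘ chartInv p) (chartMap p p) :=
  FunSmoothAt.contDiffAt_comp_chartInv (mem_extChartAt_target p) (by rwa [chartInv_chartMap_self])

theorem FunSmoothAt.ofFun (h : FunSmoothAt f p) : Form.SmoothAt (Form.ofFun f) p :=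
  (ContinuousAlternatingMap.constOfIsEmptyLIE ℝ E3 ℂ (Fin 0)).contDiff.contDiffAt.comp _
    h.contDiffAt_comp_chartInv_self

theorem dFun_eq_fderiv (hf : MDifferentiableAt (𝓡 3) 𝓘(ℝ, ℂ) f p) :
    (show E3 [⋀^Fin 1]→L[ℝ] ℂ from dFun f p) = ContinuousAlternatingMap.ofSubsingleton ℝ E3 ℂ 0
      (fderiv ℝ (f ∘ chartInv p) (chartMap p p)) := by
  have hp := mem_extChartAt_target (I := 𝓡 3) p
  rw [← mfderiv_eq_fderiv, mfderiv_comp _ (by rwa [chartInv_chartMap_self])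
    (mdifferentiableAt_chartInv hp)]
  ext v
  change mfderiv (𝓡 3) 𝓘(ℝ, ℂ) f p (v 0) =
    mfderiv (𝓡 3) 𝓘(ℝ, ℂ) f (chartInv p (chartMap p p)) (chartInvD p (chartMap p p) (v 0))
  rw [chartInvD_self, chartInv_chartMap_self]

theorem d_ofFun (hf : MDifferentiableAt (𝓡 3) 𝓘(ℝ, ℂ) f p) :
    Form.d (Form.ofFun f) p = dFun f p := by
  refine (d_eq_extDeriv _ p).trans (.trans ?_ (dFun_eq_fderiv hf).symm)
  rw [inChart_ofFun, extDeriv_constOfIsEmpty]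
  rfl

theorem FunSmoothAt.dFun_eventuallyEq_d_ofFun (hf : FunSmoothAt f p) :
    ∀ᶠ x in 𝓝 p, dFun f x = Form.d (Form.ofFun f) x := by
  have h1 : ContMDiffAt (𝓡 3) 𝓘(ℝ, ℂ) 1 f p := hf.of_le (by simp)
  filter_upwards [(contMDiffAt_iff_contMDiffAt_nhds (by simp)).1 h1] with x hx
  exact (d_ofFun (hx.mdifferentiableAt (by simp))).symm

theorem FunSmoothAt.dFun (hf : FunSmoothAt f p) : Form.SmoothAt (dFun f) p :=
  hf.ofFun.d.congr hf.dFun_eventuallyEq_d_ofFun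

theorem d_dFun (hf : FunSmoothAt f p) : Form.d (dFun f) p = 0 := by
  rw [d_congr hf.dFun_eventuallyEq_d_ofFun, d_d hf.ofFun]

end Functions

section FormOperations

open Filter Topology

variable {M : Type*} [TopologicalSpace M] [ChartedSpace E3 M] {k : ℕ} {p : M} {f : M → ℂ}

theorem inChart_wedge (α : Form M ℂ 1) (β : Form M ℂ k) (p : M) :
    Form.inChart (fun x => wedge (α x) (β x)) p =
      fun y => wedge (Form.inChart α p y) (Form.inChart β p y) := by
  ext y v
  rw [wedge_apply]
  refine (wedge_apply _ _ _).trans (Finset.sum_congr rfl fun i _ => ?_)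
  rw [inChart_apply, inChart_apply]
  congr 3
  ext j
  fin_cases j
  rfl

theorem Form.SmoothAt.wedge {α : Form M ℂ 1} {β : Form M ℂ k} (hα : Form.SmoothAt α p)
    (hβ : Form.SmoothAt β p) : Form.SmoothAt (fun x => wedge (α x) (β x)) p := by
  rw [Form.SmoothAt, inChart_wedge]
  exact contDiffAt_wedge hα hβ

theorem Form.SmoothAt.add {α β : Form M ℂ k} (hα : Form.SmoothAt α p)
    (hβ : Form.SmoothAt β p) : Form.SmoothAt (fun x => α x + β x) p :=
  ContDiffAt.add hα hβ

theorem Form.SmoothAt.sub {α β : Form M ℂ k} (hα : Form.SmoothAt α p)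
    (hβ : Form.SmoothAt β p) : Form.SmoothAt (fun x => α x - β x) p :=
  ContDiffAt.sub hα hβ

theorem Form.SmoothAt.conj {β : Form M ℂ k} (hβ : Form.SmoothAt β p) :
    Form.SmoothAt (fun x => conjForm (β x)) p :=
  contDiffAt_compContinuousAlternatingMap (Complex.conjCLE : ℂ →L[ℝ] ℂ) hβ

theorem Form.SmoothAt.ofReal {β : Form M ℝ k} (hβ : Form.SmoothAt β p) :
    Form.SmoothAt (fun x => ofRealForm (β x)) p :=
  contDiffAt_compContinuousAlternatingMap Complex.ofRealCLM hβ

variable [IsManifold (𝓡 3) ∞ M]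

theorem FunSmoothAt.of_eq_smul {Ψ Φ : Form M ℂ k} (h : ∀ᶠ x in 𝓝 p, Ψ x = f x • Φ x)
    (hΨ : Form.SmoothAt Ψ p) (hΦ : Form.SmoothAt Φ p) (h0 : Φ p ≠ 0) : FunSmoothAt f p := by
  obtain ⟨v, hv⟩ : ∃ v, Form.inChart Φ p (chartMap p p) v ≠ 0 := by
    by_contra! hzero
    exact h0 ((inChart_self Φ p).symm.trans (ContinuousAlternatingMap.ext hzero))
  have hΨv := contDiffAt_form_apply hΨ v
  have hΦv := contDiffAt_form_apply hΦ v
  refine FunSmoothAt.of_chart ((hΨv.mul (hΦv.inv hv)).congr_of_eventuallyEq ?_)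
  filter_upwards [eventually_chartInv_self h, hΦv.continuousAt.eventually_ne hv] with y hy hne
  change f (chartInv p y) = Form.inChart Ψ p y v * (Form.inChart Φ p y v)⁻¹
  rw [eq_mul_inv_iff_mul_eq₀ hne, inChart_apply, inChart_apply, hy]
  rfl

theorem Form.SmoothAt.smul {β : Form M ℂ k} (hf : FunSmoothAt f p) (hβ : Form.SmoothAt β p) :
    Form.SmoothAt (fun x => f x • β x) p :=
  ContDiffAt.smul hf.contDiffAt_comp_chartInv_self hβ

theorem d_wedge {α β : Form M ℂ 1} (hα : Form.SmoothAt α p) (hβ : Form.SmoothAt β p) :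
    Form.d (fun x => wedge (α x) (β x)) p =
      wedge (β p) (Form.d α p) - wedge (α p) (Form.d β p) := by
  refine (d_eq_extDeriv _ p).trans ?_
  rw [inChart_wedge, extDeriv_wedge hα.differentiableAt hβ.differentiableAt, inChart_self,
    inChart_self, ← d_eq_extDeriv, ← d_eq_extDeriv]
  rfl

theorem d_smul {β : Form M ℂ k} (hf : FunSmoothAt f p) (hβ : Form.SmoothAt β p) :
    Form.d (fun x => f x • β x) p = wedge (dFun f p) (β p) + f p • Form.d β p := by
  refine (d_eq_extDeriv _ p).trans ?_
  have hfp := hf.contDiffAt_comp_chartInv_self.differentiableAt (by simp)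
  refine (extDeriv_function_smul hfp hβ.differentiableAt).trans ?_
  rw [inChart_self, ← d_eq_extDeriv, ← dFun_eq_fderiv hf.mdifferentiableAt, Function.comp_apply,
    chartInv_chartMap_self]
  rfl

theorem d_add {α β : Form M ℂ k} (hα : Form.SmoothAt α p) (hβ : Form.SmoothAt β p) :
    Form.d (fun x => α x + β x) p = Form.d α p + Form.d β p := by
  refine (d_eq_extDeriv _ p).trans ?_
  refine (extDeriv_fun_add hα.differentiableAt hβ.differentiableAt).trans ?_
  rw [← d_eq_extDeriv, ← d_eq_extDeriv]
  rfl

theorem d_conj {β : Form M ℂ k} (hβ : Form.SmoothAt β p) :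
    Form.d (fun x => conjForm (β x)) p = conjForm (Form.d β p) := by
  refine (d_eq_extDeriv _ p).trans ?_
  refine (extDeriv_compContinuousAlternatingMap (Complex.conjCLE : ℂ →L[ℝ] ℂ)
    hβ.differentiableAt).trans ?_
  rw [← d_eq_extDeriv]
  rfl

theorem d_ofReal {β : Form M ℝ k} (hβ : Form.SmoothAt β p) :
    Form.d (fun x => ofRealForm (β x)) p = ofRealForm (Form.d β p) := by
  refine (d_eq_extDeriv _ p).trans ?_
  refine (extDeriv_compContinuousAlternatingMap Complex.ofRealCLM hβ.differentiableAt).trans ?_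
  rw [← d_eq_extDeriv]
  rfl

end FormOperations

section Coframes

open Filter Topology

variable {M : Type*} [TopologicalSpace M] [ChartedSpace E3 M]

/-- The basis of `T_x M` given by the coordinates of the preferred chart at `x`. -/
def tangentBasis (x : M) : Module.Basis (Fin 3) ℝ (TangentSpace (𝓡 3) x) :=
  (EuclideanSpace.basisFun (Fin 3) ℝ).toBasis

variable [IsManifold (𝓡 3) ∞ M] {S : CRStructure M}

theorem CRStructure.is10_iff {x : M} {α : TangentSpace (𝓡 3) x [⋀^Fin 1]→L[ℝ] ℂ} :
    S.Is10 x α ↔ ∀ v : S.H x, α ![(S.J x v : TangentSpace (𝓡 3) x)] =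
      Complex.I * α ![(v : TangentSpace (𝓡 3) x)] := by
  have ext_T01 (v : S.H x) : ext α ((1 : ℂ) ⊗ₜ[ℝ] (v : TangentSpace (𝓡 3) x) +
      Complex.I ⊗ₜ[ℝ] (S.J x v : TangentSpace (𝓡 3) x)) = 0 ↔
      α ![(S.J x v : TangentSpace (𝓡 3) x)] = Complex.I * α ![(v : TangentSpace (𝓡 3) x)] := by
    rw [map_add, ext_tmul, ext_tmul, one_mul]
    constructor <;> intro h
    · linear_combination (-Complex.I) * h + α ![(S.J x v : TangentSpace (𝓡 3) x)] * Complex.I_mul_I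
    · linear_combination Complex.I * h + α ![(v : TangentSpace (𝓡 3) x)] * Complex.I_mul_I
  refine ⟨fun h v => (ext_T01 v).1 (h _ (Submodule.subset_span ⟨v, rfl⟩)), fun h z hz => ?_⟩
  have hle : S.T01 x ≤ LinearMap.ker (ext α) :=
    Submodule.span_le.2 (range_subset_iff.2 fun v => (ext_T01 v).2 (h v))
  exact hle hz

namespace ContactForm

variable (θ : ContactForm S)

theorem form_reeb (x : M) : θ.form x ![θ.reeb x] = 1 := (θ.existsUnique_reeb x).choose_spec.1.1

theorem d_form_reeb (x : M) (v : TangentSpace (𝓡 3) x) : Form.d θ.form x ![θ.reeb x, v] = 0 :=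
  (θ.existsUnique_reeb x).choose_spec.1.2 v

theorem toC_reeb (x : M) : θ.toC x ![θ.reeb x] = 1 :=
  congrArg Complex.ofReal (θ.form_reeb x)

theorem toC_H {x : M} (v : S.H x) : θ.toC x ![(v : TangentSpace (𝓡 3) x)] = 0 :=
  congrArg Complex.ofReal ((θ.ker x v).2 v.2)

theorem toC_ne_zero (x : M) : θ.toC x ≠ 0 := fun h =>
  zero_ne_one ((congrArg (fun α => α ![θ.reeb x]) h).symm.trans (θ.toC_reeb x))

theorem is10_toC (x : M) : S.Is10 x (θ.toC x) :=
  CRStructure.is10_iff.2 fun v => by rw [toC_H, toC_H, mul_zero]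

theorem conj_toC (x : M) : conjForm (θ.toC x) = θ.toC x := conjForm_ofRealForm _

theorem smoothAt_toC (x : M) : Form.SmoothAt θ.toC x := Form.SmoothAt.ofReal (θ.smooth x trivial)

theorem d_toC (x : M) : Form.d θ.toC x = θ.dC x := d_ofReal (θ.smooth x trivial)

theorem d_dC (x : M) : Form.d θ.dC x = 0 := by
  rw [← funext θ.d_toC]
  exact d_d (θ.smoothAt_toC x)

theorem contract_reeb_dC (x : M) : contract (θ.reeb x) (θ.dC x) = 0 :=
  oneForm_ext fun v => congrArg Complex.ofReal (θ.d_form_reeb x v)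

variable {θ} {U : Set M}

namespace AdmissibleCoframe

variable (e : θ.AdmissibleCoframe U)

theorem bar_apply (x : M) (v : TangentSpace (𝓡 3) x) : e.bar x ![v] = conj (e.form x ![v]) := rfl

theorem conj_form (x : M) : conjForm (e.form x) = e.bar x := rfl

theorem conj_bar (x : M) : conjForm (e.bar x) = e.form x := conjForm_conjForm _

theorem bar_reeb {x : M} (hx : x ∈ U) : e.bar x ![θ.reeb x] = 0 := by
  rw [bar_apply, e.reeb x hx, map_zero]

theorem form_J {x : M} (hx : x ∈ U) (v : S.H x) :
    e.form x ![(S.J x v : TangentSpace (𝓡 3) x)] =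
      Complex.I * e.form x ![(v : TangentSpace (𝓡 3) x)] :=
  CRStructure.is10_iff.1 (e.is10 x hx) v

theorem exists_form_apply_ne_zero {x : M} (hx : x ∈ U) :
    ∃ v : S.H x, e.form x ![(v : TangentSpace (𝓡 3) x)] ≠ 0 := by
  by_contra! hzero
  obtain ⟨z, hz, hne⟩ := e.basis x hx
  have hle : S.T10 x ≤ LinearMap.ker (ext (e.form x)) := by
    refine Submodule.span_le.2 (range_subset_iff.2 fun v => ?_)
    simp only [SetLike.mem_coe, LinearMap.mem_ker, map_sub, ext_tmul, hzero, mul_zero, sub_zero]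
  exact hne (hle hz)

theorem wedge_form_bar_apply_J {x : M} (hx : x ∈ U) (v : S.H x) :
    wedge (e.form x) (e.bar x) ![(v : TangentSpace (𝓡 3) x), (S.J x v : TangentSpace (𝓡 3) x)] =
      -2 * Complex.I * Complex.normSq (e.form x ![(v : TangentSpace (𝓡 3) x)]) := by
  rw [wedge_one_apply, bar_apply, bar_apply, form_J e hx, map_mul, Complex.conj_I,
    Complex.normSq_eq_conj_mul_self]
  ring

/-- The complex volume form `θ ∧ θ¹ ∧ θ^1̄` of an admissible coframe. -/
def vol : Form M ℂ 3 := fun x => wedge (θ.toC x) (wedge (e.form x) (e.bar x))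

theorem vol_ne_zero {x : M} (hx : x ∈ U) : e.vol x ≠ 0 := by
  obtain ⟨v, hv⟩ := e.exists_form_apply_ne_zero hx
  intro h
  have hvol : e.vol x ![θ.reeb x, (v : TangentSpace (𝓡 3) x), (S.J x v : TangentSpace (𝓡 3) x)]
      = 0 := by
    rw [h]
    rfl
  rw [vol, wedge_two_apply, toC_reeb, toC_H, toC_H, wedge_form_bar_apply_J e hx] at hvol
  simp [hv] at hvol

theorem conj_vol (x : M) : conjForm (e.vol x) = (-1 : ℂ) • e.vol x := by
  rw [vol, conjForm_wedge, conjForm_wedge, θ.conj_toC, conj_form, conj_bar,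
    wedge_swap (e.bar x), ← neg_one_smul ℂ, wedge_smul_right]

theorem smoothAt_form {x : M} (hx : x ∈ U) : Form.SmoothAt e.form x := e.smooth x hx

theorem smoothAt_bar {x : M} (hx : x ∈ U) : Form.SmoothAt e.bar x := (e.smoothAt_form hx).conj

theorem smoothAt_vol {x : M} (hx : x ∈ U) : Form.SmoothAt e.vol x :=
  (θ.smoothAt_toC x).wedge ((e.smoothAt_form hx).wedge (e.smoothAt_bar hx))

theorem d_bar {x : M} (hx : x ∈ U) : Form.d e.bar x = conjForm (Form.d e.form x) :=
  d_conj (e.smoothAt_form hx)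

theorem exists_oneForm_eq {x : M} (hx : x ∈ U) (β : TangentSpace (𝓡 3) x [⋀^Fin 1]→L[ℝ] ℂ) :
    ∃ c₀ c₁ c₂ : ℂ, β = c₀ • θ.toC x + c₁ • e.form x + c₂ • e.bar x :=
  CR.exists_oneForm_eq (tangentBasis x) β (e.vol_ne_zero hx)

theorem exists_twoForm_eq {x : M} (hx : x ∈ U) (β : TangentSpace (𝓡 3) x [⋀^Fin 2]→L[ℝ] ℂ) :
    ∃ c₀₁ c₀₂ c₁₂ : ℂ, β = c₀₁ • wedge (θ.toC x) (e.form x) + c₀₂ • wedge (θ.toC x) (e.bar x) +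
      c₁₂ • wedge (e.form x) (e.bar x) :=
  CR.exists_twoForm_eq (tangentBasis x) β (e.vol_ne_zero hx)

/-- The complex vectors `z` and `z'` complete the Reeb vector to the frame `T, Z₁, Z_1̄` dual to
`θ, θ¹, θ^1̄`. Then `ext β z` and `ext β z'` are the components of a covector `β` along `θ¹` and
`θ^1̄`. -/
structure IsDualFrame (x : M) (z z' : ℂ ⊗[ℝ] TangentSpace (𝓡 3) x) : Prop where
  left : ext (θ.toC x) z = 0 ∧ ext (e.form x) z = 1 ∧ ext (e.bar x) z = 0
  right : ext (θ.toC x) z' = 0 ∧ ext (e.form x) z' = 0 ∧ ext (e.bar x) z' = 1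

theorem exists_isDualFrame {x : M} (hx : x ∈ U) : ∃ z z', e.IsDualFrame x z z' := by
  obtain ⟨v, hv⟩ := e.exists_form_apply_ne_zero hx
  set n := e.form x ![(v : TangentSpace (𝓡 3) x)] with hn
  have hcn : conj n ≠ 0 := (map_ne_zero _).2 hv
  refine ⟨(2 * n)⁻¹ • ((1 : ℂ) ⊗ₜ[ℝ] (v : TangentSpace (𝓡 3) x) -
      Complex.I ⊗ₜ[ℝ] (S.J x v : TangentSpace (𝓡 3) x)),
    (2 * conj n)⁻¹ • ((1 : ℂ) ⊗ₜ[ℝ] (v : TangentSpace (𝓡 3) x) +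
      Complex.I ⊗ₜ[ℝ] (S.J x v : TangentSpace (𝓡 3) x)), ⟨?_, ?_, ?_⟩, ⟨?_, ?_, ?_⟩⟩ <;>
  simp only [map_smul, map_sub, map_add, ext_tmul, θ.toC_H, bar_apply, e.form_J hx, map_mul,
    Complex.conj_I, ← hn, smul_eq_mul]
  · ring
  · field_simp
    linear_combination -Complex.I_mul_I
  · linear_combination ((2 * n)⁻¹ * conj n) * Complex.I_mul_I
  · ring
  · linear_combination ((2 * conj n)⁻¹ * n) * Complex.I_mul_I
  · field_simp
    linear_combination -Complex.I_mul_I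

namespace IsDualFrame

variable {e} {x : M} {z z' : ℂ ⊗[ℝ] TangentSpace (𝓡 3) x} (hz : e.IsDualFrame x z z')

include hz

theorem ext_left (c₀ c₁ c₂ : ℂ) : ext (c₀ • θ.toC x + c₁ • e.form x + c₂ • e.bar x) z = c₁ := by
  obtain ⟨h₀, h₁, h₂⟩ := hz.left
  simp [ext_add, ext_smul, h₀, h₁, h₂]

theorem ext_right (c₀ c₁ c₂ : ℂ) : ext (c₀ • θ.toC x + c₁ • e.form x + c₂ • e.bar x) z' = c₂ := by
  obtain ⟨h₀, h₁, h₂⟩ := hz.right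
  simp [ext_add, ext_smul, h₀, h₁, h₂]

theorem oneForm_eq (hx : x ∈ U) (β : TangentSpace (𝓡 3) x [⋀^Fin 1]→L[ℝ] ℂ) :
    β = β ![θ.reeb x] • θ.toC x + ext β z • e.form x + ext β z' • e.bar x := by
  obtain ⟨c₀, c₁, c₂, rfl⟩ := e.exists_oneForm_eq hx β
  rw [hz.ext_left, hz.ext_right]
  simp [θ.toC_reeb, e.reeb x hx, e.bar_reeb hx]

theorem ext_conj_left (hx : x ∈ U) (β : TangentSpace (𝓡 3) x [⋀^Fin 1]→L[ℝ] ℂ) :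
    ext (conjForm β) z = conj (ext β z') := by
  obtain ⟨c₀, c₁, c₂, rfl⟩ := e.exists_oneForm_eq hx β
  obtain ⟨h₀, h₁, h₂⟩ := hz.left
  simp [hz.ext_right, conjForm_add, conjForm_smul, θ.conj_toC, e.conj_form, e.conj_bar, ext_add,
    ext_smul, h₀, h₁, h₂]

theorem ext_conj_right (hx : x ∈ U) (β : TangentSpace (𝓡 3) x [⋀^Fin 1]→L[ℝ] ℂ) :
    ext (conjForm β) z' = conj (ext β z) := by
  rw [← conjForm_conjForm β, hz.ext_conj_left hx, Complex.conj_conj, conjForm_conjForm]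

theorem toC_wedge_wedge_bar (hx : x ∈ U) (β : TangentSpace (𝓡 3) x [⋀^Fin 1]→L[ℝ] ℂ) :
    wedge (θ.toC x) (wedge β (e.bar x)) = ext β z • e.vol x := by
  obtain ⟨c₀, c₁, c₂, rfl⟩ := e.exists_oneForm_eq hx β
  rw [hz.ext_left, vol]
  simp [wedge_add_left, wedge_add_right, wedge_smul_left, wedge_smul_right, wedge_self,
    wedge_wedge_self, form_smul_zero]

theorem toC_wedge_form_wedge (hx : x ∈ U) (β : TangentSpace (𝓡 3) x [⋀^Fin 1]→L[ℝ] ℂ) :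
    wedge (θ.toC x) (wedge (e.form x) β) = ext β z' • e.vol x := by
  obtain ⟨c₀, c₁, c₂, rfl⟩ := e.exists_oneForm_eq hx β
  rw [hz.ext_right, vol]
  simp [wedge_add_right, wedge_smul_right, wedge_self, wedge_zero_right, form_smul_zero,
    wedge_left_comm (θ.toC x) (e.form x) (θ.toC x)]

theorem toC_wedge_eq_zero_iff (hx : x ∈ U) {β : TangentSpace (𝓡 3) x [⋀^Fin 1]→L[ℝ] ℂ} :
    wedge (θ.toC x) β = 0 ↔ ext β z = 0 ∧ ext β z' = 0 := by
  refine ⟨fun h => ⟨?_, ?_⟩, fun ⟨h, h'⟩ => ?_⟩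
  · have hvol := hz.toC_wedge_wedge_bar hx β
    rw [wedge_swap, wedge_neg_right, wedge_left_comm, h, wedge_zero_right] at hvol
    exact (form_smul_eq_zero.1 (by simpa using hvol.symm)).resolve_right (e.vol_ne_zero hx)
  · have hvol := hz.toC_wedge_form_wedge hx β
    rw [wedge_left_comm, h, wedge_zero_right] at hvol
    exact (form_smul_eq_zero.1 (by simpa using hvol.symm)).resolve_right (e.vol_ne_zero hx)
  · rw [hz.oneForm_eq hx β, h, h']
    simp [wedge_smul_right, wedge_self, form_smul_zero]

end IsDualFrame

end AdmissibleCoframe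

end ContactForm

end Coframes

section ConnectionIdentities

open Filter Topology

variable {M : Type*} [TopologicalSpace M] [ChartedSpace E3 M]

theorem conj_dFun_ofReal {f : M → ℝ} {p : M} (hf : FunSmoothAt (fun x => (f x : ℂ)) p) :
    conjForm (dFun (fun x => (f x : ℂ)) p) = dFun (fun x => (f x : ℂ)) p := by
  simpa only [Complex.conj_ofReal] using (dFun_conj hf.mdifferentiableAt).symm

variable [IsManifold (𝓡 3) ∞ M]

theorem d_add_conj_d_eq_zero_of_metric {h : M → ℂ} {γ : Form M ℂ 1} {p : M}
    (hh : FunSmoothAt h p) (h0 : h p ≠ 0) (hγ : Form.SmoothAt γ p)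
    (hm : ∀ᶠ x in 𝓝 p, h x • γ x + h x • conjForm (γ x) = dFun h x) :
    Form.d γ p + conjForm (Form.d γ p) = 0 := by
  have hd : Form.d (fun x => h x • (γ x + conjForm (γ x))) p = 0 := by
    rw [d_congr (γ := dFun h) (hm.mono fun x hx => by rw [smul_add, hx]), d_dFun hh]
  rw [d_smul hh (hγ.add hγ.conj), d_add hγ hγ.conj, d_conj hγ, ← hm.self_of_nhds, ← smul_add,
    wedge_smul_left, wedge_self, form_smul_zero, zero_add] at hd
  exact (form_smul_eq_zero.1 hd).resolve_left h0

variable {S : CRStructure M} {θ : ContactForm S} {U : Set M} {e : θ.AdmissibleCoframe U}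

namespace ContactForm.TanakaWebster

variable (D : θ.TanakaWebster e)

/-- The component `A^1_1̄ = h⁻¹ Ā` of the torsion form `τ^1`. -/
def torsion (x : M) : ℂ := (D.h x : ℂ)⁻¹ * conj (D.A x)

variable {x : M} (hU : IsOpen U) (hx : x ∈ U)

include hx

theorem isDualFrame : e.IsDualFrame x (D.Z x) (D.Zbar x) := ⟨D.Z_dual x hx, D.Zbar_dual x hx⟩

theorem h_ne_zero : (D.h x : ℂ) ≠ 0 := Complex.ofReal_ne_zero.2 (D.h_pos x hx).ne'

theorem h_mul_torsion : D.h x * D.torsion x = conj (D.A x) :=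
  mul_inv_cancel_left₀ (D.h_ne_zero hx) _

include hU

theorem smoothAt_h : FunSmoothAt (fun y => (D.h y : ℂ)) x := (funSmoothOn_iff hU).1 D.h_smooth x hx

theorem smoothAt_A : FunSmoothAt D.A x := (funSmoothOn_iff hU).1 D.A_smooth x hx

theorem smoothAt_R : FunSmoothAt (fun y => (D.R y : ℂ)) x := (funSmoothOn_iff hU).1 D.R_smooth x hx

theorem smoothAt_torsion : FunSmoothAt D.torsion x :=
  ((D.smoothAt_h hU hx).inv (D.h_ne_zero hx)).mul (D.smoothAt_A hU hx).conj

theorem smoothAt_curvForm : Form.SmoothAt D.curvForm x :=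
  (D.conn_smooth x hx).add
    (Form.SmoothAt.smul ((FunSmoothAt.const _ x).mul (D.smoothAt_R hU hx)) (θ.smoothAt_toC x))

theorem h_smul_d_torsion :
    (D.h x : ℂ) • (dFun D.torsion x + D.torsion x • D.conn x
      - D.torsion x • conjForm (D.conn x)) = conjForm (dFun D.A x - (2 * D.A x) • D.conn x) := by
  have product_rule := dFun_mul (D.smoothAt_h hU hx).mdifferentiableAt
    (D.smoothAt_torsion hU hx).mdifferentiableAt
  rw [dFun_congr (g := fun y => conj (D.A y)) (eventually_of_mem (hU.mem_nhds hx)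
    fun y hy => D.h_mul_torsion hy), dFun_conj (D.smoothAt_A hU hx).mdifferentiableAt,
    ← D.metric x hx] at product_rule
  refine oneForm_ext fun v => ?_
  have hv := congrArg (fun β => β ![v]) product_rule
  simp only [ContinuousAlternatingMap.add_apply, ContinuousAlternatingMap.sub_apply,
    ContinuousAlternatingMap.smul_apply, smul_eq_mul, conjForm_apply, map_sub, map_mul,
    map_ofNat] at hv ⊢
  linear_combination -hv - 2 * conj (D.conn x ![v]) * D.h_mul_torsion hx

theorem first_bianchi {η : TangentSpace (𝓡 3) x [⋀^Fin 1]→L[ℝ] ℂ}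
    (hη : Form.d D.conn x =
      ((D.R x : ℂ) * D.h x) • wedge (e.form x) (e.bar x) + wedge (θ.toC x) η) :
    wedge (θ.toC x) (wedge (e.form x) η) =
      wedge (θ.toC x) (wedge (dFun D.torsion x + D.torsion x • D.conn x
        - D.torsion x • conjForm (D.conn x)) (e.bar x)) := by
  have hda : Form.d e.form x = wedge (e.form x) (D.conn x) +
      wedge (θ.toC x) (D.torsion x • e.bar x) := D.structure_eq x hx
  have hdb := congrArg conjForm hda
  rw [← e.d_bar hx, conjForm_add, conjForm_wedge, conjForm_wedge, conjForm_smul, θ.conj_toC,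
    e.conj_form, e.conj_bar] at hdb
  have smooth_ω := D.conn_smooth x hx
  have smooth_τ := Form.SmoothAt.smul (D.smoothAt_torsion hU hx) (e.smoothAt_bar hx)
  have hdd : Form.d (Form.d e.form) x = 0 := d_d (e.smoothAt_form hx)
  rw [d_congr (γ := fun y => wedge (e.form y) (D.conn y) + wedge (θ.toC y) (D.torsion y • e.bar y))
      (eventually_of_mem (hU.mem_nhds hx) D.structure_eq),
    d_add ((e.smoothAt_form hx).wedge smooth_ω) ((θ.smoothAt_toC x).wedge smooth_τ),
    d_wedge (e.smoothAt_form hx) smooth_ω, d_wedge (θ.smoothAt_toC x) smooth_τ,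
    d_smul (D.smoothAt_torsion hU hx) (e.smoothAt_bar hx), θ.d_toC, D.levi x hx, hη, hda,
    hdb] at hdd
  refine threeForm_ext fun u v w => ?_
  have h_apply := congrArg (fun β => β ![u, v, w]) hdd
  simp only [wedge_two_apply, wedge_one_apply, ContinuousAlternatingMap.add_apply,
    ContinuousAlternatingMap.sub_apply, ContinuousAlternatingMap.smul_apply, smul_eq_mul,
    ContinuousAlternatingMap.coe_zero, Pi.zero_apply] at h_apply ⊢
  linear_combination h_apply

theorem exists_d_conn_eq : ∃ η : TangentSpace (𝓡 3) x [⋀^Fin 1]→L[ℝ] ℂ,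
    Form.d D.conn x = ((D.R x : ℂ) * D.h x) • wedge (e.form x) (e.bar x) + wedge (θ.toC x) η ∧
      ext η (D.Z x) = -D.divA x ∧ ext η (D.Zbar x) = conj (D.divA x) := by
  have hz := D.isDualFrame hx
  obtain ⟨η, hη⟩ := D.curvature x hx
  have bianchi := D.first_bianchi hU hx hη
  rw [hz.toC_wedge_form_wedge hx, hz.toC_wedge_wedge_bar hx] at bianchi
  have η_Zbar : ext η (D.Zbar x) = conj (D.divA x) := by
    refine mul_left_cancel₀ (D.h_ne_zero hx) ?_
    rw [smul_left_injective ℂ (e.vol_ne_zero hx) bianchi, ← ext_smul, D.h_smul_d_torsion hU hx,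
      hz.ext_conj_left hx, ext_sub, ext_smul, ← Complex.conj_ofReal (D.h x), ← map_mul, divA,
      mul_inv_cancel_left₀ (D.h_ne_zero hx), mul_right_comm]
  have imaginary := d_add_conj_d_eq_zero_of_metric (D.smoothAt_h hU hx) (D.h_ne_zero hx)
    (D.conn_smooth x hx) (eventually_of_mem (hU.mem_nhds hx) D.metric)
  have wedge_imaginary : wedge (θ.toC x) (η + conjForm η) = 0 := by
    rw [hη, conjForm_add, conjForm_smul, conjForm_wedge, conjForm_wedge, θ.conj_toC, e.conj_form,
      e.conj_bar, map_mul, Complex.conj_ofReal, Complex.conj_ofReal, wedge_swap (e.bar x)]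
      at imaginary
    rw [wedge_add_right, ← imaginary]
    module
  have η_Z := ((hz.toC_wedge_eq_zero_iff hx).1 wedge_imaginary).1
  rw [ext_add, hz.ext_conj_left hx, η_Zbar, Complex.conj_conj] at η_Z
  exact ⟨η, hη, eq_neg_of_add_eq_zero_left η_Z, η_Zbar⟩

theorem exists_d_curvForm_eq : ∃ σ : TangentSpace (𝓡 3) x [⋀^Fin 1]→L[ℝ] ℂ,
    Form.d D.curvForm x = wedge (θ.toC x) σ ∧
      ext σ (D.Z x) = -Complex.I * (D.gradR x - Complex.I * D.divA x) ∧
      ext σ (D.Zbar x) = -Complex.I * conj (D.gradR x - Complex.I * D.divA x) := by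
  have hz := D.isDualFrame hx
  have smooth_R := D.smoothAt_R hU hx
  have smooth_IR : FunSmoothAt (fun y => Complex.I * (D.R y : ℂ)) x :=
    (FunSmoothAt.const _ x).mul smooth_R
  obtain ⟨η, hη, η_Z, η_Zbar⟩ := D.exists_d_conn_eq hU hx
  set dR := dFun (fun y => (D.R y : ℂ)) x with hdR
  have dR_Zbar : ext dR (D.Zbar x) = conj (D.gradR x) := by
    rw [gradR, ← hz.ext_conj_right hx, conj_dFun_ofReal smooth_R]
  refine ⟨η - Complex.I • dR, ?_, ?_, ?_⟩
  · have d_sum : Form.d D.curvForm x = Form.d D.conn x +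
        Form.d (fun y => (Complex.I * (D.R y : ℂ)) • θ.toC y) x :=
      d_add (D.conn_smooth x hx) (Form.SmoothAt.smul smooth_IR (θ.smoothAt_toC x))
    rw [d_sum, d_smul smooth_IR (θ.smoothAt_toC x), dFun_mul mdifferentiableAt_const
      smooth_R.mdifferentiableAt, dFun_const, form_smul_zero, add_zero, ← hdR, θ.d_toC,
      D.levi x hx, hη]
    refine twoForm_ext fun v w => ?_
    simp only [wedge_one_apply, ContinuousAlternatingMap.add_apply,
      ContinuousAlternatingMap.sub_apply, ContinuousAlternatingMap.smul_apply, smul_eq_mul]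
    linear_combination D.R x * D.h x * (e.form x ![v] * e.bar x ![w] - e.form x ![w] * e.bar x ![v])
      * Complex.I_mul_I
  · rw [ext_sub, ext_smul, η_Z, hdR, ← gradR]
    linear_combination (-D.divA x) * Complex.I_mul_I
  · rw [ext_sub, ext_smul, η_Zbar, dR_Zbar, map_sub, map_mul, Complex.conj_I]
    linear_combination conj (D.divA x) * Complex.I_mul_I

theorem d_curvForm_eq_zero_iff :
    Form.d D.curvForm x = 0 ↔ D.gradR x - Complex.I * D.divA x = 0 := by
  obtain ⟨σ, hσ, σ_Z, σ_Zbar⟩ := D.exists_d_curvForm_eq hU hx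
  rw [hσ, (D.isDualFrame hx).toC_wedge_eq_zero_iff hx, σ_Z, σ_Zbar]
  refine ⟨fun ⟨h, _⟩ => ?_, fun h => ?_⟩
  · simpa using h
  · rw [h, map_zero, mul_zero, and_self]

end ContactForm.TanakaWebster

theorem ContactForm.pseudoEinstein_iff (θ : ContactForm S) : θ.PseudoEinstein ↔
    ∀ U : Set M, IsOpen U → ∀ (e : θ.AdmissibleCoframe U) (D : θ.TanakaWebster e),
      ∀ x ∈ U, Form.d D.curvForm x = 0 :=
  forall₂_congr fun _ hU => forall₂_congr fun _ D => forall₂_congr fun _ hx =>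
    (D.d_curvForm_eq_zero_iff hU hx).symm

end ConnectionIdentities

section CanonicalSections

open Filter Topology

variable {M : Type*} [TopologicalSpace M] [ChartedSpace E3 M] [IsManifold (𝓡 3) ∞ M]

theorem d_inv_smul_dFun {u : M → ℂ} {p : M} (hu : FunSmoothAt u p) (h0 : u p ≠ 0) :
    Form.d (fun x => (u x)⁻¹ • dFun u x) p = 0 := by
  rw [d_smul (hu.inv h0) hu.dFun, d_dFun hu, form_smul_zero, add_zero,
    show (fun x => (u x)⁻¹) = (·⁻¹) ∘ u from rfl,
    dFun_comp_of_hasDerivAt (hasDerivAt_inv h0) hu.mdifferentiableAt, wedge_smul_left, wedge_self,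
    form_smul_zero]

variable {S : CRStructure M} {θ : ContactForm S} {U : Set M}

namespace ContactForm.AdmissibleCoframe

variable (e : θ.AdmissibleCoframe U) {x : M} (hx : x ∈ U)

include hx

theorem toC_wedge_form_ne_zero : wedge (θ.toC x) (e.form x) ≠ 0 := fun h =>
  e.vol_ne_zero hx <| by
    rw [vol, wedge_swap (e.form x), wedge_neg_right, wedge_left_comm, h, wedge_zero_right,
      neg_zero, neg_zero]

theorem exists_eq_of_is10 {α : TangentSpace (𝓡 3) x [⋀^Fin 1]→L[ℝ] ℂ} (h : S.Is10 x α) :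
    ∃ c₀ c₁ : ℂ, α = c₀ • θ.toC x + c₁ • e.form x := by
  obtain ⟨c₀, c₁, c₂, rfl⟩ := e.exists_oneForm_eq hx α
  obtain ⟨v, hv⟩ := e.exists_form_apply_ne_zero hx
  have h_apply := CRStructure.is10_iff.1 h v
  simp only [ContinuousAlternatingMap.add_apply, ContinuousAlternatingMap.smul_apply, smul_eq_mul,
    θ.toC_H, bar_apply, e.form_J hx, map_mul, Complex.conj_I] at h_apply
  have hmul : (2 * Complex.I * conj (e.form x ![(v : TangentSpace (𝓡 3) x)])) * c₂ = 0 := by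
    linear_combination -h_apply
  have hc₂ : c₂ = 0 := (mul_eq_zero.1 hmul).resolve_left (by simp [hv])
  exact ⟨c₀, c₁, by rw [hc₂, form_zero_smul, add_zero]⟩

theorem K_eq_span : S.K x = Submodule.span ℂ {wedge (θ.toC x) (e.form x)} := by
  refine le_antisymm (Submodule.span_le.2 ?_) (Submodule.span_mono (singleton_subset_iff.2
    ⟨_, _, θ.is10_toC x, e.is10 x hx, rfl⟩))
  rintro _ ⟨α, β, hα, hβ, rfl⟩
  obtain ⟨c₀, c₁, rfl⟩ := e.exists_eq_of_is10 hx hα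
  obtain ⟨d₀, d₁, rfl⟩ := e.exists_eq_of_is10 hx hβ
  refine Submodule.mem_span_singleton.2 ⟨c₀ * d₁ - c₁ * d₀, twoForm_ext fun v w => ?_⟩
  simp only [wedge_one_apply, ContinuousAlternatingMap.add_apply,
    ContinuousAlternatingMap.smul_apply, smul_eq_mul]
  ring

theorem contract_reeb_toC_wedge_form :
    contract (θ.reeb x) (wedge (θ.toC x) (e.form x)) = e.form x := by
  rw [contract_wedge_one, θ.toC_reeb, e.reeb x hx, one_smul, form_zero_smul,
    sub_zero]

end ContactForm.AdmissibleCoframe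

namespace ContactForm.TanakaWebster

variable {e : θ.AdmissibleCoframe U} (D : θ.TanakaWebster e) {x : M}

theorem volumeNormalized_iff (hx : x ∈ U) (u : ℂ) :
    wedge (θ.toC x) (θ.dC x) = Complex.I • wedge (θ.toC x)
      (wedge (contract (θ.reeb x) (u • wedge (θ.toC x) (e.form x)))
        (contract (θ.reeb x) (conjForm (u • wedge (θ.toC x) (e.form x))))) ↔
    (D.h x : ℂ) = u * conj u := by
  rw [D.levi x hx, contract_conjForm, contract_smul, e.contract_reeb_toC_wedge_form hx,
    conjForm_smul, e.conj_form, wedge_smul_left, wedge_smul_right, wedge_smul_right,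
    wedge_smul_right, wedge_smul_right, smul_smul, smul_smul, mul_assoc]
  refine ⟨fun h => ?_, fun h => by rw [h]⟩
  exact mul_left_cancel₀ Complex.I_ne_zero (smul_left_injective ℂ (e.vol_ne_zero hx) h)

theorem d_smul_toC_wedge_form (hx : x ∈ U) {u : M → ℂ} (hu : FunSmoothAt u x) :
    Form.d (fun y => u y • wedge (θ.toC y) (e.form y)) x =
      ext (dFun u x - u x • D.conn x) (D.Zbar x) • e.vol x := by
  have hθ := θ.smoothAt_toC x
  have he := e.smoothAt_form hx
  rw [← (D.isDualFrame hx).toC_wedge_form_wedge hx, d_smul hu (hθ.wedge he), d_wedge hθ he,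
    θ.d_toC, D.levi x hx, D.structure_eq x hx]
  refine threeForm_ext fun v w w' => ?_
  simp only [wedge_two_apply, wedge_one_apply, ContinuousAlternatingMap.add_apply,
    ContinuousAlternatingMap.sub_apply, ContinuousAlternatingMap.smul_apply, smul_eq_mul]
  ring

theorem toC_wedge_dFun_sub_eq_zero (hx : x ∈ U) {u : M → ℂ} (hu : FunSmoothAt u x)
    (h0 : u x ≠ 0) (hh : ∀ᶠ y in 𝓝 x, (D.h y : ℂ) = u y * conj (u y))
    (hd : Form.d (fun y => u y • wedge (θ.toC y) (e.form y)) x = 0) :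
    wedge (θ.toC x) (dFun u x - u x • D.conn x) = 0 := by
  have hz := D.isDualFrame hx
  set σ := dFun u x - u x • D.conn x with hσ
  rw [D.d_smul_toC_wedge_form hx hu, form_smul_eq_zero, or_iff_left (e.vol_ne_zero hx)] at hd
  have hσ_conj : conj (u x) • σ + u x • conjForm σ = 0 := by
    have metric := D.metric x hx
    rw [dFun_congr hh, dFun_mul hu.mdifferentiableAt hu.conj.mdifferentiableAt,
      dFun_conj hu.mdifferentiableAt, hh.self_of_nhds] at metric
    refine oneForm_ext fun v => ?_
    have hv := congrArg (fun β => β ![v]) metric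
    simp only [hσ, ContinuousAlternatingMap.add_apply, ContinuousAlternatingMap.sub_apply,
      ContinuousAlternatingMap.smul_apply, smul_eq_mul, conjForm_apply, map_sub, map_mul,
      ContinuousAlternatingMap.coe_zero, Pi.zero_apply] at hv ⊢
    linear_combination -hv
  have hσ_Z : conj (u x) * ext σ (D.Z x) = 0 := by
    have h_ext := congrArg (fun β => ext β (D.Z x)) hσ_conj
    rwa [ext_add, ext_smul, ext_smul, hz.ext_conj_left hx, hd, map_zero, mul_zero, add_zero,
      ext_zero] at h_ext
  exact (hz.toC_wedge_eq_zero_iff hx).2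
    ⟨(mul_eq_zero.1 hσ_Z).resolve_left ((map_ne_zero _).2 h0), hd⟩

theorem exists_curvForm_eq_add (hx : x ∈ U) {u : M → ℂ} (hu : FunSmoothAt u x)
    (h0 : u x ≠ 0) (hh : ∀ᶠ y in 𝓝 x, (D.h y : ℂ) = u y * conj (u y))
    (hd : Form.d (fun y => u y • wedge (θ.toC y) (e.form y)) x = 0) :
    ∃ c : ℂ, D.curvForm x = (u x)⁻¹ • dFun u x + c • θ.toC x := by
  have hz := D.isDualFrame hx
  have hσ := hz.oneForm_eq hx (dFun u x - u x • D.conn x)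
  obtain ⟨hZ, hZbar⟩ := (hz.toC_wedge_eq_zero_iff hx).1
    (D.toC_wedge_dFun_sub_eq_zero hx hu h0 hh hd)
  rw [hZ, hZbar, form_zero_smul, form_zero_smul, add_zero, add_zero] at hσ
  generalize (dFun u x - u x • D.conn x) ![θ.reeb x] = c at hσ
  have hconn : D.conn x = (u x)⁻¹ • dFun u x - (u x)⁻¹ • (dFun u x - u x • D.conn x) := by
    rw [smul_sub, smul_smul, inv_mul_cancel₀ h0, one_smul, sub_sub_cancel]
  rw [hσ] at hconn
  exact ⟨-((u x)⁻¹ * c) + Complex.I * D.R x, by rw [curvForm, hconn]; module⟩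

/-- `d(ω_1^1 + i R θ)` is a multiple of `θ`, whereas `d(f θ)` has `θ¹ ∧ θ^1̄` component `i h f`. -/
theorem eq_zero_of_curvForm_eq_add (hU : IsOpen U) (hx : x ∈ U) {β : Form M ℂ 1} {f : M → ℂ}
    (hβ : Form.SmoothAt β x) (hdβ : Form.d β x = 0)
    (h : ∀ᶠ y in 𝓝 x, D.curvForm y = β y + f y • θ.toC y) : f x = 0 := by
  have hθ := θ.smoothAt_toC x
  have hf : FunSmoothAt f x := FunSmoothAt.of_eq_smul
    (Ψ := fun y => D.curvForm y - β y) (h.mono fun y hy => by rw [hy, add_sub_cancel_left])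
    ((D.smoothAt_curvForm hU hx).sub hβ) hθ (θ.toC_ne_zero x)
  have hwedge : wedge (θ.toC x) (Form.d D.curvForm x) = 0 := by
    obtain ⟨σ, hσ, -⟩ := D.exists_d_curvForm_eq hU hx
    rw [hσ, wedge_wedge_self]
  rw [d_congr h, d_add hβ (Form.SmoothAt.smul hf hθ), hdβ, zero_add, d_smul hf hθ, θ.d_toC,
    D.levi x hx, wedge_add_right, wedge_swap (dFun f x), wedge_neg_right, wedge_wedge_self,
    neg_zero, zero_add, smul_smul, wedge_smul_right, form_smul_eq_zero] at hwedge
  exact (mul_eq_zero.1 (hwedge.resolve_right (e.vol_ne_zero hx))).resolve_right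
    (mul_ne_zero Complex.I_ne_zero (D.h_ne_zero hx))

theorem d_curvForm_eq_zero_of_closed (hU : IsOpen U) {W : Set M} (hW : IsOpen W) (hWU : W ⊆ U)
    {u : M → ℂ} (hu : ∀ y ∈ W, FunSmoothAt u y) (h0 : ∀ y ∈ W, u y ≠ 0)
    (hh : ∀ y ∈ W, (D.h y : ℂ) = u y * conj (u y))
    (hd : ∀ y ∈ W, Form.d (fun y => u y • wedge (θ.toC y) (e.form y)) y = 0) (hx : x ∈ W) :
    Form.d D.curvForm x = 0 := by
  have exists_coeff (y : M) (hy : y ∈ W) :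
      ∃ c : ℂ, D.curvForm y = (u y)⁻¹ • dFun u y + c • θ.toC y :=
    D.exists_curvForm_eq_add (hWU hy) (hu y hy) (h0 y hy)
      (eventually_of_mem (hW.mem_nhds hy) hh) (hd y hy)
  choose! f hf using exists_coeff
  have hf0 (y : M) (hy : y ∈ W) : f y = 0 :=
    D.eq_zero_of_curvForm_eq_add hU (hWU hy)
      (Form.SmoothAt.smul ((hu y hy).inv (h0 y hy)) (hu y hy).dFun)
      (d_inv_smul_dFun (hu y hy) (h0 y hy)) (eventually_of_mem (hW.mem_nhds hy) hf)
  rw [d_congr (γ := fun y => (u y)⁻¹ • dFun u y) (eventually_of_mem (hW.mem_nhds hx)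
    fun y hy => by rw [hf y hy, hf0 y hy, form_zero_smul, add_zero])]
  exact d_inv_smul_dFun (hu x hx) (h0 x hx)

end ContactForm.TanakaWebster

theorem ContactForm.pseudoEinstein_of_sections (θ : ContactForm S)
    (H : ∀ p : M, ∃ U : Set M, IsOpen U ∧ p ∈ U ∧
        ∃ ξ : Form M ℂ 2, S.IsCanonicalSection U ξ ∧ (∀ x ∈ U, ξ x ≠ 0) ∧
          (∀ x ∈ U, Form.d ξ x = 0) ∧ θ.VolumeNormalizedOn U ξ) : θ.PseudoEinstein := by
  intro U hU e D x hx
  rw [← D.d_curvForm_eq_zero_iff hU hx]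
  obtain ⟨U', hU', hxU', ξ, ⟨hξ_smooth, hξ_mem⟩, hξ_ne, hξ_closed, hξ_vol⟩ := H x
  have hW := hU.inter hU'
  have exists_coeff (y : M) (hy : y ∈ U ∩ U') : ∃ u : ℂ, ξ y = u • wedge (θ.toC y) (e.form y) := by
    obtain ⟨u, hu⟩ := Submodule.mem_span_singleton.1 (e.K_eq_span hy.1 ▸ hξ_mem y hy.2)
    exact ⟨u, hu.symm⟩
  choose! u hu using exists_coeff
  have hu_near (y : M) (hy : y ∈ U ∩ U') := eventually_of_mem (hW.mem_nhds hy) hu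
  have u_smooth (y : M) (hy : y ∈ U ∩ U') : FunSmoothAt u y :=
    FunSmoothAt.of_eq_smul (hu_near y hy) (hξ_smooth y hy.2)
      ((θ.smoothAt_toC y).wedge (e.smoothAt_form hy.1)) (e.toC_wedge_form_ne_zero hy.1)
  refine D.d_curvForm_eq_zero_of_closed hU hW inter_subset_left u_smooth (fun y hy h => ?_)
    (fun y hy => ?_) (fun y hy => ?_) ⟨hx, hxU'⟩
  · exact hξ_ne y hy.2 (by rw [hu y hy, h, form_zero_smul])
  · have hvol := hξ_vol y hy.2
    rw [hu y hy] at hvol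
    exact (D.volumeNormalized_iff hy.1 (u y)).1 hvol
  · rw [← d_congr (hu_near y hy)]
    exact hξ_closed y hy.2

end CanonicalSections

section Existence

open Filter Topology

variable {M : Type*} [TopologicalSpace M] [ChartedSpace E3 M] [IsManifold (𝓡 3) ∞ M]
variable {S : CRStructure M} {θ : ContactForm S} {U : Set M}

theorem ContactForm.smoothAt_dC (θ : ContactForm S) (x : M) : Form.SmoothAt θ.dC x := by
  rw [← funext θ.d_toC]
  exact (θ.smoothAt_toC x).d

namespace ContactForm.AdmissibleCoframe

variable (e : θ.AdmissibleCoframe U)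

theorem toC_wedge_twoForm {x : M} (c₀₁ c₀₂ c₁₂ : ℂ) :
    wedge (θ.toC x) (c₀₁ • wedge (θ.toC x) (e.form x) + c₀₂ • wedge (θ.toC x) (e.bar x) +
      c₁₂ • wedge (e.form x) (e.bar x)) = c₁₂ • e.vol x := by
  rw [wedge_add_right, wedge_add_right, wedge_smul_right, wedge_smul_right, wedge_smul_right,
    wedge_wedge_self, wedge_wedge_self, form_smul_zero, form_smul_zero, zero_add, zero_add, vol]

theorem form_wedge_twoForm {x : M} (c₀₁ c₀₂ c₁₂ : ℂ) :
    wedge (e.form x) (c₀₁ • wedge (θ.toC x) (e.form x) + c₀₂ • wedge (θ.toC x) (e.bar x) +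
      c₁₂ • wedge (e.form x) (e.bar x)) = (-c₀₂) • e.vol x := by
  rw [wedge_add_right, wedge_add_right, wedge_smul_right, wedge_smul_right, wedge_smul_right,
    wedge_wedge_self, wedge_left_comm, wedge_self, wedge_zero_right,
    wedge_left_comm (e.form x), vol]
  module

theorem bar_wedge_twoForm {x : M} (c₀₁ c₀₂ c₁₂ : ℂ) :
    wedge (e.bar x) (c₀₁ • wedge (θ.toC x) (e.form x) + c₀₂ • wedge (θ.toC x) (e.bar x) +
      c₁₂ • wedge (e.form x) (e.bar x)) = c₀₁ • e.vol x := by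
  rw [wedge_add_right, wedge_add_right, wedge_smul_right, wedge_smul_right, wedge_smul_right,
    wedge_left_comm _ (θ.toC x) (e.bar x), wedge_left_comm _ (e.form x), wedge_self,
    wedge_zero_right, wedge_zero_right, wedge_left_comm, wedge_swap (e.bar x), wedge_neg_right, vol]
  module

theorem wedge_form_bar {x : M} (hx : x ∈ U) (β : TangentSpace (𝓡 3) x [⋀^Fin 1]→L[ℝ] ℂ) :
    wedge β (wedge (e.form x) (e.bar x)) = β ![θ.reeb x] • e.vol x := by
  obtain ⟨c₀, c₁, c₂, rfl⟩ := e.exists_oneForm_eq hx β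
  rw [wedge_add_left, wedge_add_left, wedge_smul_left, wedge_smul_left, wedge_smul_left,
    wedge_wedge_self, wedge_left_comm (e.bar x), wedge_self, wedge_zero_right, vol]
  simp [θ.toC_reeb, e.reeb x hx, e.bar_reeb hx, form_smul_zero]

theorem exists_smooth_twoForm_eq (hU : IsOpen U) {β : Form M ℂ 2}
    (hβ : ∀ x ∈ U, Form.SmoothAt β x) :
    ∃ c₀₁ c₀₂ c₁₂ : M → ℂ,
      (∀ x ∈ U, FunSmoothAt c₀₁ x ∧ FunSmoothAt c₀₂ x ∧ FunSmoothAt c₁₂ x) ∧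
      ∀ x ∈ U, β x = c₀₁ x • wedge (θ.toC x) (e.form x) + c₀₂ x • wedge (θ.toC x) (e.bar x) +
        c₁₂ x • wedge (e.form x) (e.bar x) := by
  choose! c₀₁ c₀₂ c₁₂ hc using fun (x : M) (hx : x ∈ U) => e.exists_twoForm_eq hx (β x)
  refine ⟨c₀₁, c₀₂, c₁₂, fun x hx => ?_, hc⟩
  have near {Ψ : Form M ℂ 3} {c : M → ℂ} (h : ∀ y ∈ U, Ψ y = c y • e.vol y)
      (hΨ : Form.SmoothAt Ψ x) : FunSmoothAt c x :=
    FunSmoothAt.of_eq_smul (eventually_of_mem (hU.mem_nhds hx) h) hΨ (e.smoothAt_vol hx)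
      (e.vol_ne_zero hx)
  have smooth_neg : FunSmoothAt (fun y => -c₀₂ y) x :=
    near (fun y hy => by rw [hc y hy, e.form_wedge_twoForm]) ((e.smoothAt_form hx).wedge (hβ x hx))
  refine ⟨near (fun y hy => by rw [hc y hy, e.bar_wedge_twoForm])
    ((e.smoothAt_bar hx).wedge (hβ x hx)), ?_, near (fun y hy => by rw [hc y hy,
    e.toC_wedge_twoForm]) ((θ.smoothAt_toC x).wedge (hβ x hx))⟩
  simpa only [neg_neg] using smooth_neg.neg

theorem exists_oneForm_eq_add_conj {x : M} (hx : x ∈ U)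
    {β : TangentSpace (𝓡 3) x [⋀^Fin 1]→L[ℝ] ℂ} (hβ : conjForm β = β) (hT : β ![θ.reeb x] = 0) :
    ∃ c : ℂ, β = c • e.form x + conj c • e.bar x := by
  obtain ⟨z, z', hz⟩ := e.exists_isDualFrame hx
  refine ⟨ext β z, ?_⟩
  have hβz := hz.ext_conj_right hx β
  rw [hβ] at hβz
  rw [← hβz]
  conv_lhs => rw [hz.oneForm_eq hx β, hT, form_zero_smul, zero_add]

theorem exists_pos_dC_eq {x : M} (hx : x ∈ U) :
    ∃ h : ℝ, 0 < h ∧ θ.dC x = (Complex.I * h) • wedge (e.form x) (e.bar x) := by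
  obtain ⟨c₀, c₁, c₂, hc⟩ := e.exists_twoForm_eq hx (θ.dC x)
  obtain ⟨z, z', hz⟩ := e.exists_isDualFrame hx
  have horizontal : (0 : ℂ) • θ.toC x + c₀ • e.form x + c₁ • e.bar x = 0 := by
    rw [← θ.contract_reeb_dC x, hc]
    simp [contract_add, contract_smul, contract_wedge_one, θ.toC_reeb, e.reeb x hx, e.bar_reeb hx,
      form_zero_smul]
  have hc₀ : c₀ = 0 := by rw [← hz.ext_left 0 c₀ c₁, horizontal, ext_zero]
  have hc₁ : c₁ = 0 := by rw [← hz.ext_right 0 c₀ c₁, horizontal, ext_zero]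
  rw [hc₀, hc₁, form_zero_smul, form_zero_smul, zero_add, zero_add] at hc
  obtain ⟨v, hv⟩ := e.exists_form_apply_ne_zero hx
  have hv0 : v ≠ 0 := by
    rintro rfl
    exact hv ((e.form x).map_coord_zero 0 rfl)
  have normSq_pos := Complex.normSq_pos.2 hv
  set n := Complex.normSq (e.form x ![(v : TangentSpace (𝓡 3) x)])
  set d := Form.d θ.form x ![(v : TangentSpace (𝓡 3) x), (S.J x v : TangentSpace (𝓡 3) x)]
  have levi_apply : (d : ℂ) = c₂ * (-2 * Complex.I * n) :=
    (congrArg (fun β => β ![(v : TangentSpace (𝓡 3) x), (S.J x v : TangentSpace (𝓡 3) x)])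
      hc).trans (congrArg (c₂ * ·) (e.wedge_form_bar_apply_J hx v))
  refine ⟨d / (2 * n), div_pos (θ.pos x v hv0) (by positivity), ?_⟩
  have hn : (n : ℂ) ≠ 0 := Complex.ofReal_ne_zero.2 normSq_pos.ne'
  rw [hc]
  congr 1
  push_cast
  rw [levi_apply]
  field_simp
  linear_combination c₂ * Complex.I_sq

theorem exists_smooth_levi (hU : IsOpen U) : ∃ h : M → ℝ,
    (∀ x ∈ U, FunSmoothAt (fun y => (h y : ℂ)) x) ∧ (∀ x ∈ U, 0 < h x) ∧
      ∀ x ∈ U, θ.dC x = (Complex.I * h x) • wedge (e.form x) (e.bar x) := by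
  choose! h hpos hlevi using fun (x : M) (hx : x ∈ U) => e.exists_pos_dC_eq hx
  refine ⟨h, fun x hx => ?_, hpos, hlevi⟩
  refine FunSmoothAt.of_eq_smul (eventually_of_mem (hU.mem_nhds hx) fun y hy => ?_)
    (θ.smoothAt_dC x)
    (Form.SmoothAt.smul (FunSmoothAt.const Complex.I x)
      ((e.smoothAt_form hx).wedge (e.smoothAt_bar hx))) fun h0 => e.vol_ne_zero hx ?_
  · rw [hlevi y hy, smul_smul, mul_comm]
  · rw [vol, (form_smul_eq_zero.1 h0).resolve_left Complex.I_ne_zero, wedge_zero_right]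

theorem exists_smooth_preconnection (hU : IsOpen U) : ∃ (γ : Form M ℂ 1) (q : M → ℂ),
    (∀ x ∈ U, Form.SmoothAt γ x) ∧ (∀ x ∈ U, FunSmoothAt q x) ∧
      ∀ x ∈ U, Form.d e.form x = wedge (e.form x) (γ x) + wedge (θ.toC x) (q x • e.bar x) := by
  obtain ⟨p, q, r, smooth, hd⟩ := e.exists_smooth_twoForm_eq hU fun x hx => (e.smoothAt_form hx).d
  refine ⟨fun x => (-p x) • θ.toC x + r x • e.bar x, q, fun x hx => ?_,
    fun x hx => (smooth x hx).2.1, fun x hx => ?_⟩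
  · exact (Form.SmoothAt.smul (smooth x hx).1.neg (θ.smoothAt_toC x)).add
      (Form.SmoothAt.smul (smooth x hx).2.2 (e.smoothAt_bar hx))
  · rw [hd x hx, wedge_add_right, wedge_smul_right, wedge_smul_right, wedge_smul_right,
      wedge_swap (e.form x) (θ.toC x)]
    module

/-- The identity `d(dθ) = 0` says that the Reeb derivative of `h` agrees with the one that metric
compatibility prescribes. -/
theorem dFun_levi_apply_reeb (hU : IsOpen U) {h : M → ℂ} {γ : Form M ℂ 1} {q : M → ℂ} {x : M}
    (hx : x ∈ U) (hh : FunSmoothAt h x)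
    (levi : ∀ y ∈ U, θ.dC y = (Complex.I * h y) • wedge (e.form y) (e.bar y))
    (hd : Form.d e.form x = wedge (e.form x) (γ x) + wedge (θ.toC x) (q x • e.bar x)) :
    (dFun h x - h x • γ x - h x • conjForm (γ x)) ![θ.reeb x] = 0 := by
  have ha := e.smoothAt_form hx
  have hb := e.smoothAt_bar hx
  have hIh := (FunSmoothAt.const Complex.I x).mul hh
  have hdb := congrArg conjForm hd
  rw [← e.d_bar hx, conjForm_add, conjForm_wedge, conjForm_wedge, conjForm_smul, θ.conj_toC,
    e.conj_form, e.conj_bar] at hdb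
  have hdd := θ.d_dC x
  rw [d_congr (eventually_of_mem (hU.mem_nhds hx) levi), d_smul hIh (ha.wedge hb), d_wedge ha hb,
    dFun_mul (FunSmoothAt.const _ x).mdifferentiableAt hh.mdifferentiableAt, dFun_const,
    form_smul_zero, add_zero, hd, hdb] at hdd
  have hvol : Complex.I • wedge (dFun h x - h x • γ x - h x • conjForm (γ x))
      (wedge (e.form x) (e.bar x)) = 0 := by
    rw [← hdd]
    refine threeForm_ext fun u v w => ?_
    simp only [wedge_two_apply, wedge_one_apply, ContinuousAlternatingMap.add_apply,
      ContinuousAlternatingMap.sub_apply, ContinuousAlternatingMap.smul_apply, smul_eq_mul]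
    ring
  rw [e.wedge_form_bar hx, form_smul_eq_zero, form_smul_eq_zero] at hvol
  exact (hvol.resolve_left Complex.I_ne_zero).resolve_right (e.vol_ne_zero hx)

theorem exists_smooth_connection (hU : IsOpen U) {h : M → ℝ}
    (hh : ∀ x ∈ U, FunSmoothAt (fun y => (h y : ℂ)) x) (h0 : ∀ x ∈ U, (h x : ℂ) ≠ 0)
    (levi : ∀ x ∈ U, θ.dC x = (Complex.I * h x) • wedge (e.form x) (e.bar x)) :
    ∃ (γ : Form M ℂ 1) (q : M → ℂ), (∀ x ∈ U, Form.SmoothAt γ x) ∧ (∀ x ∈ U, FunSmoothAt q x) ∧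
      (∀ x ∈ U, Form.d e.form x = wedge (e.form x) (γ x) + wedge (θ.toC x) (q x • e.bar x)) ∧
      ∀ x ∈ U, (h x : ℂ) • γ x + (h x : ℂ) • conjForm (γ x) = dFun (fun y => (h y : ℂ)) x := by
  obtain ⟨γ, q, hγ, hq, hd⟩ := e.exists_smooth_preconnection hU
  let κ : Form M ℂ 1 := fun x =>
    dFun (fun y => (h y : ℂ)) x - (h x : ℂ) • γ x - (h x : ℂ) • conjForm (γ x)
  have κ_real (x : M) (hx : x ∈ U) : conjForm (κ x) = κ x := by
    refine oneForm_ext fun v => ?_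
    have hv := congrArg (fun β => β ![v]) (conj_dFun_ofReal (hh x hx))
    simp only [κ, conjForm_apply, ContinuousAlternatingMap.sub_apply,
      ContinuousAlternatingMap.smul_apply, smul_eq_mul, map_sub, map_mul, Complex.conj_ofReal,
      Complex.conj_conj] at hv ⊢
    linear_combination hv
  choose! c hc using fun (x : M) (hx : x ∈ U) => e.exists_oneForm_eq_add_conj hx (κ_real x hx)
    (e.dFun_levi_apply_reeb hU hx (hh x hx) levi (hd x hx))
  have c_smooth (x : M) (hx : x ∈ U) : FunSmoothAt c x := by
    have κ_smooth : Form.SmoothAt κ x :=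
      ((hh x hx).dFun.sub (Form.SmoothAt.smul (hh x hx) (hγ x hx))).sub
        (Form.SmoothAt.smul (hh x hx) (hγ x hx).conj)
    refine FunSmoothAt.of_eq_smul (eventually_of_mem (hU.mem_nhds hx) fun y hy => ?_)
      ((θ.smoothAt_toC x).wedge (κ_smooth.wedge (e.smoothAt_bar hx))) (e.smoothAt_vol hx)
      (e.vol_ne_zero hx)
    rw [hc y hy, wedge_add_left, wedge_smul_left, wedge_smul_left, wedge_self, form_smul_zero,
      add_zero, wedge_smul_right, vol]
  refine ⟨fun x => γ x + ((h x : ℂ)⁻¹ * c x) • e.form x, q, fun x hx => ?_, hq, fun x hx => ?_,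
    fun x hx => ?_⟩
  · exact (hγ x hx).add (Form.SmoothAt.smul (((hh x hx).inv (h0 x hx)).mul (c_smooth x hx))
      (e.smoothAt_form hx))
  · rw [hd x hx, wedge_add_right, wedge_smul_right (_ * _), wedge_self, form_smul_zero, add_zero]
  · rw [conjForm_add, conjForm_smul, e.conj_form, map_mul, map_inv₀, Complex.conj_ofReal, smul_add,
      smul_add, smul_smul, smul_smul, mul_inv_cancel_left₀ (h0 x hx),
      mul_inv_cancel_left₀ (h0 x hx), add_add_add_comm, ← hc x hx]
    module

theorem exists_smooth_curvature (hU : IsOpen U) {h : M → ℝ} {γ : Form M ℂ 1}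
    (hh : ∀ x ∈ U, FunSmoothAt (fun y => (h y : ℂ)) x) (h0 : ∀ x ∈ U, (h x : ℂ) ≠ 0)
    (hγ : ∀ x ∈ U, Form.SmoothAt γ x)
    (metric : ∀ x ∈ U,
      (h x : ℂ) • γ x + (h x : ℂ) • conjForm (γ x) = dFun (fun y => (h y : ℂ)) x) :
    ∃ R : M → ℝ, (∀ x ∈ U, FunSmoothAt (fun y => (R y : ℂ)) x) ∧ ∀ x ∈ U,
      ∃ η : TangentSpace (𝓡 3) x [⋀^Fin 1]→L[ℝ] ℂ, Form.d γ x =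
        ((R x : ℂ) * h x) • wedge (e.form x) (e.bar x) + wedge (θ.toC x) η := by
  obtain ⟨k, l, m, smooth, hd⟩ := e.exists_smooth_twoForm_eq hU fun x hx => (hγ x hx).d
  have m_real (x : M) (hx : x ∈ U) : conj (m x) = m x := by
    have imaginary := congrArg (wedge (θ.toC x)) (d_add_conj_d_eq_zero_of_metric (hh x hx)
      (h0 x hx) (hγ x hx) (eventually_of_mem (hU.mem_nhds hx) metric))
    have m_vol : wedge (θ.toC x) (Form.d γ x) = m x • e.vol x := by
      rw [hd x hx, e.toC_wedge_twoForm]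
    have m_conj_vol := congrArg conjForm m_vol
    rw [conjForm_wedge, θ.conj_toC, conjForm_smul, e.conj_vol] at m_conj_vol
    have hvol : (conj (m x) - m x) • e.vol x = 0 := by
      rw [wedge_add_right, m_vol, m_conj_vol, wedge_zero_right] at imaginary
      rw [← neg_eq_zero, ← imaginary]
      module
    exact sub_eq_zero.1 ((form_smul_eq_zero.1 hvol).resolve_right (e.vol_ne_zero hx))
  have hR (x : M) (hx : x ∈ U) : (((m x).re / h x : ℝ) : ℂ) = m x * (h x : ℂ)⁻¹ := by
    rw [Complex.ofReal_div, Complex.conj_eq_iff_re.1 (m_real x hx), div_eq_mul_inv]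
  refine ⟨fun x => (m x).re / h x, fun x hx => ?_, fun x hx =>
    ⟨k x • e.form x + l x • e.bar x, ?_⟩⟩
  · exact ((smooth x hx).2.2.mul ((hh x hx).inv (h0 x hx))).congr_of_eventuallyEq
      (eventually_of_mem (hU.mem_nhds hx) hR)
  · rw [hR x hx, inv_mul_cancel_right₀ (h0 x hx), hd x hx, wedge_add_right, wedge_smul_right,
      wedge_smul_right]
    exact add_comm _ _

theorem nonempty_tanakaWebster (hU : IsOpen U) : Nonempty (θ.TanakaWebster e) := by
  obtain ⟨h, hh, hpos, levi⟩ := e.exists_smooth_levi hU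
  have h0 (x : M) (hx : x ∈ U) : (h x : ℂ) ≠ 0 := Complex.ofReal_ne_zero.2 (hpos x hx).ne'
  obtain ⟨γ, q, hγ, hq, structure_eq, metric⟩ := e.exists_smooth_connection hU hh h0 levi
  obtain ⟨R, hR, curvature⟩ := e.exists_smooth_curvature hU hh h0 hγ metric
  choose! Z Zbar hZ using fun (x : M) (hx : x ∈ U) => e.exists_isDualFrame hx
  exact ⟨{
    h := h
    Z := Z
    Zbar := Zbar
    conn := γ
    A := fun x => h x * conj (q x)
    R := R
    h_smooth := (funSmoothOn_iff hU).2 hh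
    h_pos := hpos
    levi := levi
    Z_dual := fun x hx => (hZ x hx).left
    Zbar_dual := fun x hx => (hZ x hx).right
    conn_smooth := hγ
    A_smooth := (funSmoothOn_iff hU).2 fun x hx => (hh x hx).mul (hq x hx).conj
    structure_eq := fun x hx => by
      rw [map_mul, Complex.conj_ofReal, Complex.conj_conj, inv_mul_cancel_left₀ (h0 x hx)]
      exact structure_eq x hx
    metric := metric
    R_smooth := (funSmoothOn_iff hU).2 hR
    curvature := curvature }⟩

end ContactForm.AdmissibleCoframe

end Existence

section ComplexLines

variable {V : Type*} [AddCommGroup V] [Module ℝ V] {J : V →ₗ[ℝ] V}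

theorem linearIndependent_pair_of_sq_eq_neg (hJ : ∀ v, J (J v) = -v) {v : V} (hv : v ≠ 0) :
    LinearIndependent ℝ ![v, J v] := by
  refine (LinearIndependent.pair_iff' hv).2 fun a ha => ?_
  have hsq : (a * a + 1) • v = 0 := by
    rw [add_smul, mul_smul, ha, ← map_smul, ha, hJ, one_smul, neg_add_cancel]
  exact hv ((smul_eq_zero.1 hsq).resolve_left
    (add_pos_of_nonneg_of_pos (mul_self_nonneg a) one_pos).ne')

theorem exists_eq_smul_add_smul_of_finrank_eq_two (hJ : ∀ v, J (J v) = -v)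
    (hV : Module.finrank ℝ V = 2) {v : V} (hv : v ≠ 0) (w : V) :
    ∃ a b : ℝ, w = a • v + b • J v := by
  have := Module.finite_of_finrank_eq_succ hV
  have hspan := (linearIndependent_pair_of_sq_eq_neg hJ hv).span_eq_top_of_card_eq_finrank'
    (by rw [Fintype.card_fin, hV])
  rw [Matrix.range_cons_cons_empty] at hspan
  obtain ⟨a, b, hab⟩ := Submodule.mem_span_pair.1 (hspan ▸ Submodule.mem_top : w ∈ _)
  exact ⟨a, b, hab.symm⟩

end ComplexLines

section LocalExistence

open Filter Topology

variable {M : Type*} [TopologicalSpace M] [ChartedSpace E3 M] [IsManifold (𝓡 3) ∞ M]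

theorem VField.SmoothOn.contDiffAt_inChart {X : VField M} {U : Set M} (hU : IsOpen U)
    (hX : VField.SmoothOn X U) {p : M} (hp : p ∈ U) :
    ContDiffAt ℝ ∞ (fun y => chartD p (chartInv p y) (show E3 from X (chartInv p y)))
      (chartMap p p) := by
  have coordinates_smooth : ContMDiffAt (𝓡 3) 𝓘(ℝ, E3) ∞
      (fun x => chartD p x (show E3 from X x)) p := by
    refine ((Bundle.contMDiffAt_section p).1
      ((hX p hp).contMDiffAt (hU.mem_nhds hp))).congr_of_eventuallyEq ?_
    filter_upwards [chart_source_mem_nhds E3 p] with x hx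
    rw [← (trivializationAt E3 (TangentSpace (𝓡 3)) p).continuousLinearMapAt_apply_of_mem
      (R := ℝ) (by rwa [TangentBundle.trivializationAt_baseSet]) (X x),
      TangentBundle.continuousLinearMapAt_trivializationAt (I := 𝓡 3) hx]
    rfl
  have chartInv_smooth : ContMDiffAt 𝓘(ℝ, E3) (𝓡 3) ∞ (chartInv p) (chartMap p p) := by
    have h := contMDiffWithinAt_extChartAt_symm_range (I := 𝓡 3) (n := ∞) p
      (mem_extChartAt_target p)
    rwa [ModelWithCorners.range_eq_univ, contMDiffWithinAt_univ] at h
  refine (ContMDiffAt.comp (chartMap p p) (g := fun x => chartD p x (show E3 from X x)) ?_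
    chartInv_smooth).contDiffAt
  rwa [chartInv_chartMap_self]

theorem Form.SmoothAt.contract {k : ℕ} {X : VField M} {U : Set M} (hU : IsOpen U)
    (hX : VField.SmoothOn X U) {p : M} (hp : p ∈ U) {β : Form M ℂ (k + 1)}
    (hβ : Form.SmoothAt β p) : Form.SmoothAt (fun x => CR.contract (X x) (β x)) p := by
  refine contDiffAt_form_iff.2 fun v => ?_
  have hXβ := contDiffAt_form_apply_apply hβ (v := fun i y => Matrix.vecCons
    (chartD p (chartInv p y) (show E3 from X (chartInv p y))) v i) <| by
      refine Fin.cases ?_ fun j => ?_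
      · exact hX.contDiffAt_inChart hU hp
      · exact contDiffAt_const
  refine hXβ.congr_of_eventuallyEq ?_
  filter_upwards [eventually_mem_target (mem_extChartAt_target p)] with y hy
  rw [inChart_apply, inChart_apply]
  refine (contract_apply _ _ _).trans (form_congr_point β rfl (funext <| Fin.cases ?_ fun _ => rfl))
  have h := chartInvD_chartD ((extChartAt (𝓡 3) p).map_target hy)
    (show E3 from X (chartInv p y))
  rw [chartMap_chartInv hy] at h
  exact h.symm

theorem exists_dFun_eq_of_closed {γ : Form M ℂ 1} {U : Set M} (hU : IsOpen U)
    (hγ : ∀ x ∈ U, Form.SmoothAt γ x) (hd : ∀ x ∈ U, Form.d γ x = 0) {p : M} (hp : p ∈ U) :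
    ∃ W : Set M, IsOpen W ∧ p ∈ W ∧ W ⊆ U ∧
      ∃ v : M → ℂ, (∀ x ∈ W, FunSmoothAt v x) ∧ ∀ x ∈ W, dFun v x = γ x := by
  obtain ⟨ε, hε, hball⟩ := Metric.eventually_nhds_iff_ball.1
    ((eventually_mem_target (mem_extChartAt_target p)).and
      (eventually_chartInv_self (hU.mem_nhds hp)))
  set B := Metric.ball (chartMap p p) ε
  have hB : IsOpen B := Metric.isOpen_ball
  have smooth_inChart (y : E3) (hy : y ∈ B) : ContDiffAt ℝ ∞ (Form.inChart γ p) y :=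
    Form.SmoothAt.contDiffAt_inChart (hball y hy).1 (hγ _ (hball y hy).2)
  have differentiable_inChart (y : E3) (hy : y ∈ B) : DifferentiableAt ℝ (Form.inChart γ p) y :=
    (smooth_inChart y hy).differentiableAt (by simp)
  obtain ⟨f, hf⟩ := exists_hasFDerivAt_of_extDeriv_eq_zero (convex_ball (chartMap p p) ε) hB
    (fun y hy => (differentiable_inChart y hy).differentiableWithinAt) fun y hy => by
      rw [← inChart_d (hball y hy).1 (differentiable_inChart y hy)]
      ext v
      rw [inChart_apply, hd _ (hball y hy).2]
      rfl
  have smooth_f : ContDiffOn ℝ ∞ f B := by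
    refine (contDiffOn_infty_iff_fderiv_of_isOpen hB).2
      ⟨fun y hy => (hf y hy).differentiableAt.differentiableWithinAt, ?_⟩
    refine ContDiffOn.congr (fun y hy => ContDiffAt.contDiffWithinAt ?_)
      fun y hy => (hf y hy).fderiv
    let g : (E3 [⋀^Fin 1]→L[ℝ] ℂ) ≃ₗᵢ[ℝ] (E3 →L[ℝ] ℂ) :=
      (ContinuousAlternatingMap.ofSubsingletonLIE (0 : Fin 1)).symm
    exact g.contDiff.contDiffAt.comp y (smooth_inChart y hy)
  refine ⟨(extChartAt (𝓡 3) p).source ∩ chartMap p ⁻¹' B,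
    (continuousOn_extChartAt p).isOpen_inter_preimage (isOpen_extChartAt_source p) hB,
    ⟨mem_extChartAt_source p, Metric.mem_ball_self hε⟩, fun x ⟨hx, hxB⟩ => ?_, f ∘ chartMap p,
    fun x ⟨hx, hxB⟩ => ?_, fun x ⟨hx, hxB⟩ => oneForm_ext fun v => ?_⟩
  · exact chartInv_chartMap hx ▸ (hball _ hxB).2
  · exact (smooth_f.contDiffAt (hB.mem_nhds hxB)).comp_contMDiffAt
      (contMDiffAt_extChartAt' (by rwa [← extChartAt_source (𝓡 3)]))
  · rw [dFun, ((hf _ hxB).hasMFDerivAt.comp x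
      (mdifferentiableAt_chartMap hx).hasMFDerivAt).mfderiv]
    exact form_congr_point γ (chartInv_chartMap hx) (funext <| Fin.forall_fin_one.2 <|
      chartInvD_chartD hx v)

variable {S : CRStructure M}

theorem CRStructure.finrank_H (S : CRStructure M) (x : M) : Module.finrank ℝ (S.H x) = 2 := by
  obtain ⟨U, -, hxU, X, Y, -, -, hXY⟩ := S.smooth_H x
  obtain ⟨independent, hspan⟩ := hXY x hxU
  rw [← hspan, ← Matrix.range_cons_cons_empty (X x) (Y x) ![]]
  exact (finrank_span_eq_card independent).trans (Fintype.card_fin 2)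

theorem CRStructure.exists_smooth_section (S : CRStructure M) (p : M) :
    ∃ U : Set M, IsOpen U ∧ p ∈ U ∧ ∃ X X' : VField M, VField.SmoothOn X U ∧
      VField.SmoothOn X' U ∧ ∀ x ∈ U, ∃ v : S.H x, v ≠ 0 ∧ X x = v ∧ X' x = S.J x v := by
  classical
  obtain ⟨U, hU, hpU, X, Y, hX, -, hXY⟩ := S.smooth_H p
  have hXH (x : M) (hx : x ∈ U) : X x ∈ S.H x :=
    (hXY x hx).2 ▸ Submodule.subset_span (mem_insert _ _)
  have exists_J (x : M) (hx : x ∈ U) : ∃ w, w = (S.J x ⟨X x, hXH x hx⟩ : TangentSpace (𝓡 3) x) :=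
    ⟨_, rfl⟩
  choose! X' hX' using exists_J
  refine ⟨U, hU, hpU, X, X', hX, S.smooth_J U X X' hU hX fun x hx =>
    ⟨hXH x hx, (hX' x hx).symm⟩, fun x hx => ⟨⟨X x, hXH x hx⟩, fun h => ?_, rfl, hX' x hx⟩⟩
  exact (hXY x hx).1.ne_zero 0 (congrArg Subtype.val h)

namespace ContactForm

variable (θ : ContactForm S)

/-- The covector `i (v ⌟ dθ) - v' ⌟ dθ`. If `v` is a nonzero vector of `H` and `v' = J v`, then it
is a `(1,0)`-covector that annihilates the Reeb vector but not `T^{1,0}`. -/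
def leviCovector (x : M) (v v' : TangentSpace (𝓡 3) x) : TangentSpace (𝓡 3) x [⋀^Fin 1]→L[ℝ] ℂ :=
  Complex.I • contract v (θ.dC x) - contract v' (θ.dC x)

theorem leviCovector_apply (x : M) (v v' w : TangentSpace (𝓡 3) x) :
    θ.leviCovector x v v' ![w] = Complex.I * θ.dC x ![v, w] - θ.dC x ![v', w] := rfl

theorem leviCovector_apply_reeb (x : M) (v v' : TangentSpace (𝓡 3) x) :
    θ.leviCovector x v v' ![θ.reeb x] = 0 := by
  have hreeb (w : TangentSpace (𝓡 3) x) : θ.dC x ![θ.reeb x, w] = 0 :=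
    congrArg Complex.ofReal (θ.d_form_reeb x w)
  rw [leviCovector_apply, twoForm_swap, twoForm_swap _ v', hreeb, hreeb]
  simp

theorem leviCovector_apply_left (x : M) (v v' : TangentSpace (𝓡 3) x) :
    θ.leviCovector x v v' ![v] = θ.dC x ![v, v'] := by
  rw [leviCovector_apply, twoForm_self, twoForm_swap]
  ring

theorem leviCovector_apply_right (x : M) (v v' : TangentSpace (𝓡 3) x) :
    θ.leviCovector x v v' ![v'] = Complex.I * θ.dC x ![v, v'] := by
  rw [leviCovector_apply, twoForm_self, sub_zero]

variable {x : M} {v : S.H x} (hv : v ≠ 0)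

include hv

theorem is10_leviCovector : S.Is10 x (θ.leviCovector x v (S.J x v)) := by
  refine CRStructure.is10_iff.2 fun w => ?_
  obtain ⟨a, b, rfl⟩ := exists_eq_smul_add_smul_of_finrank_eq_two (S.J_sq x) (S.finrank_H x) hv w
  simp only [map_add, map_smul, S.J_sq, Submodule.coe_add, Submodule.coe_smul, Submodule.coe_neg,
    ← toLin_apply, map_neg]
  simp only [toLin_apply, leviCovector_apply_left, leviCovector_apply_right, Complex.real_smul]
  linear_combination (-b * θ.dC x ![(v : TangentSpace (𝓡 3) x),
    (S.J x v : TangentSpace (𝓡 3) x)]) * Complex.I_mul_I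

theorem exists_ext_leviCovector_ne_zero :
    ∃ z ∈ S.T10 x, ext (θ.leviCovector x v (S.J x v)) z ≠ 0 := by
  refine ⟨_, Submodule.subset_span ⟨v, rfl⟩, ?_⟩
  rw [map_sub, ext_tmul, ext_tmul, leviCovector_apply_left, leviCovector_apply_right,
    ← mul_assoc, Complex.I_mul_I, one_mul, neg_one_mul, sub_neg_eq_add, ← two_mul]
  exact mul_ne_zero two_ne_zero (Complex.ofReal_ne_zero.2 (θ.pos x v hv).ne')

omit hv

theorem exists_admissibleCoframe (p : M) :
    ∃ U : Set M, IsOpen U ∧ p ∈ U ∧ Nonempty (θ.AdmissibleCoframe U) := by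
  obtain ⟨U, hU, hpU, X, X', hX, hX', hXX'⟩ := S.exists_smooth_section p
  refine ⟨U, hU, hpU, ⟨{
    form := fun x => θ.leviCovector x (X x) (X' x)
    smooth := fun x hx => Form.SmoothAt.sub
      (Form.SmoothAt.smul (FunSmoothAt.const _ x) ((θ.smoothAt_dC x).contract hU hX hx))
      ((θ.smoothAt_dC x).contract hU hX' hx)
    is10 := fun x hx => ?_
    basis := fun x hx => ?_
    reeb := fun x _ => θ.leviCovector_apply_reeb x _ _ }⟩⟩ <;>
  obtain ⟨v, hv, hXv, hXv'⟩ := hXX' x hx <;>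
  rw [hXv, hXv']
  · exact θ.is10_leviCovector hv
  · exact θ.exists_ext_leviCovector_ne_zero hv

end ContactForm

namespace ContactForm.TanakaWebster

variable {θ : ContactForm S} {U : Set M} {e : θ.AdmissibleCoframe U} (D : θ.TanakaWebster e)

theorem h_smul_curvForm_add_conj {x : M} (hx : x ∈ U) :
    (D.h x : ℂ) • (D.curvForm x + conjForm (D.curvForm x)) = dFun (fun y => (D.h y : ℂ)) x := by
  rw [← D.metric x hx, curvForm, conjForm_add, conjForm_smul, θ.conj_toC, map_mul, Complex.conj_I,
    Complex.conj_ofReal]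
  module

theorem dFun_log_h (hU : IsOpen U) {x : M} (hx : x ∈ U) :
    FunSmoothAt (fun y => Complex.log (D.h y)) x ∧
      dFun (fun y => Complex.log (D.h y)) x = D.curvForm x + conjForm (D.curvForm x) := by
  have slit : (D.h x : ℂ) ∈ Complex.slitPlane := Complex.ofReal_mem_slitPlane.2 (D.h_pos x hx)
  refine ⟨ContDiffAt.comp_contMDiffAt (f := fun y => (D.h y : ℂ))
    ((Complex.contDiffAt_log slit).restrict_scalars ℝ) (D.smoothAt_h hU hx), ?_⟩
  refine (dFun_comp_of_hasDerivAt (f := fun y => (D.h y : ℂ)) (Complex.hasDerivAt_log slit)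
    (D.smoothAt_h hU hx).mdifferentiableAt).trans ?_
  rw [← D.h_smul_curvForm_add_conj hx, smul_smul, inv_mul_cancel₀ (D.h_ne_zero hx), one_smul]

theorem exists_dFun_eq_smul_curvForm (hU : IsOpen U) {W : Set M} (hWU : W ⊆ U) {v : M → ℂ}
    (hv : ∀ x ∈ W, FunSmoothAt v x) (hdv : ∀ x ∈ W, dFun v x = D.curvForm x) :
    ∃ u : M → ℂ, (∀ x ∈ W, FunSmoothAt u x) ∧ (∀ x ∈ W, dFun u x = u x • D.curvForm x) ∧
      ∀ x ∈ W, (D.h x : ℂ) = u x * conj (u x) := by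
  -- The real part of `v` is `(log h) / 2` up to a constant; taking it to be exactly this
  -- makes `u = exp v` satisfy `|u|² = h`.
  let g : M → ℂ := fun x => Complex.log (D.h x) + (v x - conj (v x))
  have smooth_g (x : M) (hx : x ∈ W) : FunSmoothAt g x :=
    (D.dFun_log_h hU (hWU hx)).1.add ((hv x hx).sub (hv x hx).conj)
  have dg (x : M) (hx : x ∈ W) : dFun g x = (2 : ℂ) • D.curvForm x := by
    have hvx := (hv x hx).mdifferentiableAt
    rw [dFun_add (D.dFun_log_h hU (hWU hx)).1.mdifferentiableAt
      ((hv x hx).sub (hv x hx).conj).mdifferentiableAt, (D.dFun_log_h hU (hWU hx)).2,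
      dFun_sub hvx (hv x hx).conj.mdifferentiableAt, dFun_conj hvx, hdv x hx]
    module
  have g_add_conj (x : M) (hx : x ∈ W) : g x / 2 + conj (g x / 2) = Complex.log (D.h x) := by
    have log_real : conj (Complex.log (D.h x)) = Complex.log (D.h x) := by
      rw [← Complex.ofReal_log (D.h_pos x (hWU hx)).le, Complex.conj_ofReal]
    simp only [g, map_div₀, map_add, map_sub, Complex.conj_conj, log_real, map_ofNat]
    ring
  refine ⟨fun x => Complex.exp (g x / 2), fun x hx => ?_, fun x hx => ?_, fun x hx => ?_⟩
  · exact ((Complex.contDiff_exp.comp (contDiff_id.div_const 2)).contDiffAt (𝕜 := ℝ)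
      ).comp_contMDiffAt (smooth_g x hx)
  · refine (dFun_comp_of_hasDerivAt ((hasDerivAt_id (g x)).div_const 2).cexp
      (smooth_g x hx).mdifferentiableAt).trans ?_
    rw [dg x hx, smul_smul]
    congr 1
    simp only [id_eq]
    ring
  · rw [← Complex.exp_conj, ← Complex.exp_add, g_add_conj x hx,
      Complex.exp_log (D.h_ne_zero (hWU hx))]

end ContactForm.TanakaWebster

theorem ContactForm.PseudoEinstein.exists_section {θ : ContactForm S} (hθ : θ.PseudoEinstein)
    (p : M) : ∃ U : Set M, IsOpen U ∧ p ∈ U ∧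
      ∃ ξ : Form M ℂ 2, S.IsCanonicalSection U ξ ∧ (∀ x ∈ U, ξ x ≠ 0) ∧
        (∀ x ∈ U, Form.d ξ x = 0) ∧ θ.VolumeNormalizedOn U ξ := by
  obtain ⟨U, hU, hpU, ⟨e⟩⟩ := θ.exists_admissibleCoframe p
  obtain ⟨D⟩ := e.nonempty_tanakaWebster hU
  obtain ⟨W, hW, hpW, hWU, v, hv, hdv⟩ := exists_dFun_eq_of_closed hU
    (fun x hx => D.smoothAt_curvForm hU hx) (θ.pseudoEinstein_iff.1 hθ U hU e D) hpU
  obtain ⟨u, hu, hdu, norm_u⟩ := D.exists_dFun_eq_smul_curvForm hU hWU hv hdv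
  have u_ne_zero (x : M) (hx : x ∈ W) : u x ≠ 0 := fun h =>
    D.h_ne_zero (hWU hx) (by rw [norm_u x hx, h, zero_mul])
  refine ⟨W, hW, hpW, fun x => u x • wedge (θ.toC x) (e.form x), ⟨fun x hx => ?_, fun x hx => ?_⟩,
    fun x hx => ?_, fun x hx => ?_, fun x hx => ?_⟩
  · exact Form.SmoothAt.smul (hu x hx) ((θ.smoothAt_toC x).wedge (e.smoothAt_form (hWU hx)))
  · rw [e.K_eq_span (hWU hx)]
    exact Submodule.smul_mem _ _ (Submodule.mem_span_singleton_self _)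
  · exact fun h => (form_smul_eq_zero.1 h).elim (u_ne_zero x hx) (e.toC_wedge_form_ne_zero (hWU hx))
  · rw [D.d_smul_toC_wedge_form (hWU hx) (hu x hx), hdu x hx, ext_sub, ext_smul, ext_smul,
      TanakaWebster.curvForm, ext_add, ext_smul, (D.Zbar_dual x (hWU hx)).1, mul_zero, add_zero,
      sub_self, form_zero_smul]
  · exact (D.volumeNormalized_iff (hWU hx) (u x)).2 (norm_u x hx)

end LocalExistence

end CR

end

theorem mainTheorem6 {M : Type*} [TopologicalSpace M]
    [ChartedSpace (EuclideanSpace ℝ (Fin 3)) M] [IsManifold (𝓡 3) ∞ M]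
    (S : CR.CRStructure M) (θ : CR.ContactForm S) :
    (θ.PseudoEinstein ↔
      ∀ p : M, ∃ U : Set M, IsOpen U ∧ p ∈ U ∧
        ∃ ξ : CR.Form M ℂ 2, S.IsCanonicalSection U ξ ∧ (∀ x ∈ U, ξ x ≠ 0) ∧
          (∀ x ∈ U, CR.Form.d ξ x = 0) ∧ θ.VolumeNormalizedOn U ξ) ∧
    (θ.PseudoEinstein ↔
      ∀ U : Set M, IsOpen U → ∀ (e : θ.AdmissibleCoframe U) (D : θ.TanakaWebster e),
        ∀ x ∈ U, CR.Form.d D.curvForm x = 0) :=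
  ⟨⟨fun h p => h.exists_section p, θ.pseudoEinstein_of_sections⟩, θ.pseudoEinstein_iff⟩
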